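/- Let $\mathcal L_{PA}=\{\cdot,+,\le,0,1,S\}$, and let $\mathcal L_{PAT}$ and $\mathcal L_{PAP}$ be $\mathcal L_{PA}$ with a fresh unary predicate $T$, respectively $P$, added. Let $\mathrm{CT}^-$ be the $\mathcal L_{PAT}$-theory extending $\mathrm{PA}$ (with induction for $\mathcal L_{PA}$-formulae only) by the axioms stating that $T$ is compositional: for all (codes of) closed terms $s,t$ and all arithmetical sentences $\phi,\psi$, $T(s=t)\leftrightarrow s^\circ=t^\circ$ and $T(s\le t)\leftrightarrow s^\circ\le t^\circ$, where $t^\circ$ is the value of $t$; $T(\neg\phi)\leftrightarrow\neg T(\phi)$; $T(\phi\wedge\psi)\leftrightarrow T(\phi)\wedge T(\psi)$; $T(\phi\vee\psi)\leftrightarrow T(\phi)\vee T(\psi)$; and, for every formula $\phi$ and variable $x$ such that $\exists x\,\phi$ (equivalently $\forall x\,\phi$) is a sentence, $T(\exists x\,\phi(x))\leftrightarrow\exists t\;T(\phi(t))$ and $T(\forall x\,\phi(x))\leftrightarrow\forall t\;T(\phi(t))$, with $t$ ranging over closed terms. For an $\mathcal L_{PAP}$-formula $\delta$ and a formula $\phi(x)$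 (possibly in a larger language, possibly with parameters), let $\delta[\phi]$ be the result of replacing every subformula $P(s)$ of $\delta$ by $\phi(s)$, bound variables being renamed to avoid clashes. If a formula has free variables, to say that it holds in a model means that its universal closure does. **Main Lemma.** Let $(M,T)\models\mathrm{CT}^-$ with $M$ nonstandard, and let $\delta$ be an $\mathcal L_{PAP}$-formula such that $(M,T)\models\delta[\phi]$ for every standard arithmetical formula $\phi(x)$ with at most one free variable (and without parameters). Then there is an $\mathcal L_{PAT}$-formula $T'(x)$ with parameters from $M$ such that $$(M,T)\models T'\bigl(\ulcorner\psi(t_1,\dots,t_n)\urcorner\bigr)\leftrightarrow\psi(t_1^\circ,\dots,t_n^\circ)$$ for every standard arithmetical formula $\psi(x_1,\dots,x_n)$ and all (possibly nonstandard) closed terms $t_1,\dots,t_n$ in the sense of $M$, and moreover $(M,T)\models\delta[T']$. -/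

import Mathlib

open FirstOrder FirstOrder.Language

universe u

namespace CTPaper

/-! ### The languages -/

/-- Function symbols of arithmetic: `0`, `1`, `S`, `+`, `·`. -/
inductive ArithFunc : ℕ → Type
  | zero : ArithFunc 0
  | one : ArithFunc 0
  | succ : ArithFunc 1
  | add : ArithFunc 2
  | mul : ArithFunc 2

/-- The only relation symbol of arithmetic (besides equality): `≤`. -/
inductive ArithRel : ℕ → Type
  | le : ArithRel 2

/-- The language of Peano arithmetic. -/
def LPA : Language := ⟨ArithFunc, ArithRel⟩

/-- A single unary predicate symbol. -/
inductive UnaryRel : ℕ → Type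
  | pred : UnaryRel 1

/-- The language with one unary predicate symbol and nothing else. -/
def LPred : Language := ⟨fun _ => Empty, UnaryRel⟩

/-- The language of arithmetic with one unary predicate `P` added. -/
abbrev LPAP : Language := LPA.sum LPred

/-- The language of arithmetic with one unary predicate `T` added. -/
abbrev LPAT : Language := LPA.sum LPred

/-! ### Peano arithmetic -/

section PeanoArithmetic

variable {α : Type*}

def tZero : LPA.Term α := Term.func (ArithFunc.zero : LPA.Functions 0) ![]
def tOne : LPA.Term α := Term.func (ArithFunc.one : LPA.Functions 0) ![]
def tSucc (t : LPA.Term α) : LPA.Term α := Term.func (ArithFunc.succ : LPA.Functions 1) ![t]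
def tAdd (t s : LPA.Term α) : LPA.Term α := Term.func (ArithFunc.add : LPA.Functions 2) ![t, s]
def tMul (t s : LPA.Term α) : LPA.Term α := Term.func (ArithFunc.mul : LPA.Functions 2) ![t, s]
def fLe {n : ℕ} (t s : LPA.Term (α ⊕ Fin n)) : LPA.BoundedFormula α n :=
  BoundedFormula.rel (ArithRel.le : LPA.Relations 2) ![t, s]

/-- The induction axiom for `φ(p₁, …, pₙ, x)`:
`∀ p₁ … pₙ, φ(p, 0) ∧ (∀ x, φ(p, x) → φ(p, S x)) → ∀ x, φ(p, x)`. -/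
noncomputable def inductionAxiom {n : ℕ} (φ : LPA.Formula ((Empty ⊕ Fin n) ⊕ Unit)) :
    LPA.Sentence :=
  let φ0 : LPA.Formula (Empty ⊕ Fin n) := φ.subst (Sum.elim Term.var fun _ => tZero)
  let φS : LPA.Formula ((Empty ⊕ Fin n) ⊕ Unit) :=
    φ.subst (Sum.elim (fun p => Term.var (Sum.inl p)) fun x => tSucc (Term.var (Sum.inr x)))
  Formula.iAlls (Fin n)
    ((φ0 ⊓ Formula.iAlls Unit (φ.imp φS)).imp (Formula.iAlls Unit φ))

/-- Peano arithmetic in the language `{·, +, ≤, 0, 1, S}`. -/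
inductive PA : LPA.Theory
  | one_eq : PA ((tOne =' tSucc tZero : LPA.BoundedFormula Empty 0))
  | succ_ne_zero : PA (∀' ∼(tSucc (&0) =' tZero))
  | succ_inj : PA (∀' ∀' ((tSucc (&0) =' tSucc (&1)) ⟹ ((&0) =' (&1))))
  | add_zero : PA (∀' (tAdd (&0) tZero =' (&0)))
  | add_succ : PA (∀' ∀' (tAdd (&0) (tSucc (&1)) =' tSucc (tAdd (&0) (&1))))
  | mul_zero : PA (∀' (tMul (&0) tZero =' tZero))
  | mul_succ : PA (∀' ∀' (tMul (&0) (tSucc (&1)) =' tAdd (tMul (&0) (&1)) (&0)))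
  | le_iff : PA (∀' ∀' ((fLe (&0) (&1)) ⇔ (∃' (tAdd (&0) (&2) =' (&1)))))
  | induction {n : ℕ} (φ : LPA.Formula ((Empty ⊕ Fin n) ⊕ Unit)) : PA (inductionAxiom φ)

end PeanoArithmetic

/-! ### Substituting a formula for the predicate `P` -/

section Substitution

variable {L' : Language} {α : Type*}

/-- Terms of `LPAP` are arithmetical; read them in an expansion of `LPA`. -/
def liftTerm {β : Type*} (e : LPA →ᴸ L') : LPAP.Term β → L'.Term β
  | .var x => .var x
  | .func (Sum.inl f) ts => .func (e.onFunction f) fun i => liftTerm e (ts i)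
  | .func (Sum.inr f) _ => Empty.elim f

/-- `δ[φ]`: every subformula `P(t)` of `δ` is replaced by `φ(t)`. -/
def substPred (e : LPA →ᴸ L') (φ : L'.Formula (Fin 1)) :
    {n : ℕ} → LPAP.BoundedFormula α n → L'.BoundedFormula α n
  | _, .falsum => .falsum
  | _, .equal t s => .equal (liftTerm e t) (liftTerm e s)
  | _, .rel (Sum.inl R) ts => .rel (e.onRelation R) fun i => liftTerm e (ts i)
  | _, .rel (Sum.inr UnaryRel.pred) ts =>
      BoundedFormula.relabel (k := 0) id (BoundedFormula.subst φ fun _ => liftTerm e (ts 0))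
  | _, .imp f g => .imp (substPred e φ f) (substPred e φ g)
  | _, .all f => .all (substPred e φ f)

end Substitution

/-! ### Arithmetic operations of an `LPA`-structure -/

section Operations

variable {M : Type u} [LPA.Structure M]

abbrev zeroInst : Zero M := ⟨Structure.funMap (L := LPA) ArithFunc.zero ![]⟩
abbrev oneInst : One M := ⟨Structure.funMap (L := LPA) ArithFunc.one ![]⟩
abbrev addInst : Add M := ⟨fun x y => Structure.funMap (L := LPA) ArithFunc.add ![x, y]⟩
abbrev mulInst : Mul M := ⟨fun x y => Structure.funMap (L := LPA) ArithFunc.mul ![x, y]⟩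
abbrev leInst : LE M := ⟨fun x y => Structure.RelMap (L := LPA) ArithRel.le ![x, y]⟩

/-- The successor operation of `M`. -/
def sc (x : M) : M := Structure.funMap (L := LPA) ArithFunc.succ ![x]

attribute [local instance] zeroInst oneInst addInst mulInst leInst

/-- The standard element `S … S 0` of `M`. -/
def std : ℕ → M
  | 0 => 0
  | n + 1 => sc (std n)

variable (M) in
/-- `M` has an element that is not a standard natural number. -/
def Nonstandard : Prop := ∃ c : M, ∀ n : ℕ, c ≠ std n

/-! ### Coding inside `M`

All predicates below are first-order conditions evaluated in `M`: their quantifiers range over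
elements of `M`, so that they speak about possibly nonstandard terms and formulae. -/

/-- An injective pairing. -/
def pair (x y : M) : M := (x + y) * (x + y) + x

/-- Gödel's `β` function: `y` is the remainder of `a` modulo `1 + (i + 1) b`. -/
def Beta (a b i y : M) : Prop := ∃ q : M, a = q * sc (sc i * b) + y ∧ y ≤ sc i * b

/-- `x` is the last entry of a sequence coded in `M` each of whose entries is obtained by `Step`
from the set of the earlier entries. For a monotone `Step` this is how arithmetic expresses that
`x` belongs to the set inductively generated by `Step`. -/
def Generated (Step : Set M → M → Prop) (x : M) : Prop :=
  ∃ a b n : M, Beta a b n x ∧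
    ∀ i y : M, i ≤ n → Beta a b i y → Step {z | ∃ j : M, sc j ≤ i ∧ Beta a b j z} y

/-! Codes of variables, function symbols, atomic formulae, connectives and quantifiers. -/

def cVar (i : M) : M := pair (std 0) i
def cZero : M := pair (std 1) (std 0)
def cOne : M := pair (std 1) (std 1)
def cSucc (t : M) : M := pair (std 2) t
def cAdd (t s : M) : M := pair (std 3) (pair t s)
def cMul (t s : M) : M := pair (std 4) (pair t s)
def cEq (t s : M) : M := pair (std 5) (pair t s)
def cLe (t s : M) : M := pair (std 6) (pair t s)
def cNeg (φ : M) : M := pair (std 7) φ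
def cAnd (φ ψ : M) : M := pair (std 8) (pair φ ψ)
def cOr (φ ψ : M) : M := pair (std 9) (pair φ ψ)
def cEx (i φ : M) : M := pair (std 10) (pair i φ)
def cAll (i φ : M) : M := pair (std 11) (pair i φ)

/-- `x` is (the code of) a term in the sense of `M`. -/
def IsTerm : M → Prop :=
  Generated fun X y =>
    (∃ i, y = cVar i) ∨ y = cZero ∨ y = cOne ∨
    (∃ t ∈ X, y = cSucc t) ∨
    (∃ t ∈ X, ∃ s ∈ X, y = cAdd t s ∨ y = cMul t s)

/-- `x` is a closed term in the sense of `M`. -/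
def IsClTerm : M → Prop :=
  Generated fun X y =>
    y = cZero ∨ y = cOne ∨
    (∃ t ∈ X, y = cSucc t) ∨
    (∃ t ∈ X, ∃ s ∈ X, y = cAdd t s ∨ y = cMul t s)

/-- `t° = x`: the closed term `t` has the value `x` in the sense of `M`. -/
def HasValue (t x : M) : Prop :=
  Generated (fun X p =>
    p = pair cZero 0 ∨ p = pair cOne 1 ∨
    (∃ t x, pair t x ∈ X ∧ p = pair (cSucc t) (sc x)) ∨
    (∃ t x s y, pair t x ∈ X ∧ pair s y ∈ X ∧
      (p = pair (cAdd t s) (x + y) ∨ p = pair (cMul t s) (x * y)))) (pair t x)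

/-- `x` is (the code of) an arithmetical formula in the sense of `M`. -/
def IsForm : M → Prop :=
  Generated fun X y =>
    (∃ t s, IsTerm t ∧ IsTerm s ∧ (y = cEq t s ∨ y = cLe t s)) ∨
    (∃ φ ∈ X, y = cNeg φ) ∨
    (∃ φ ∈ X, ∃ ψ ∈ X, y = cAnd φ ψ ∨ y = cOr φ ψ) ∨
    (∃ i, ∃ φ ∈ X, y = cEx i φ ∨ y = cAll i φ)

/-- The `i`-th variable occurs in the term `t`. -/
def OccursIn (i : M) : M → Prop :=
  Generated fun X y =>
    y = cVar i ∨
    (∃ t ∈ X, y = cSucc t) ∨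
    (∃ t s, IsTerm t ∧ IsTerm s ∧ (t ∈ X ∨ s ∈ X) ∧ (y = cAdd t s ∨ y = cMul t s))

/-- The `i`-th variable occurs free in the formula `φ`. -/
def FreeIn (i : M) : M → Prop :=
  Generated fun X y =>
    (∃ t s, IsTerm t ∧ IsTerm s ∧ (OccursIn i t ∨ OccursIn i s) ∧ (y = cEq t s ∨ y = cLe t s)) ∨
    (∃ φ ∈ X, y = cNeg φ) ∨
    (∃ φ ψ, IsForm φ ∧ IsForm ψ ∧ (φ ∈ X ∨ ψ ∈ X) ∧ (y = cAnd φ ψ ∨ y = cOr φ ψ)) ∨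
    (∃ j, ∃ φ ∈ X, j ≠ i ∧ (y = cEx j φ ∨ y = cAll j φ))

/-- `φ` is an arithmetical sentence in the sense of `M`. -/
def IsSent (φ : M) : Prop := IsForm φ ∧ ∀ i : M, ¬ FreeIn i φ

/-- `u'` results from the term `u` by substituting the term `t` for the `i`-th variable. -/
def SubstTerm (i t u u' : M) : Prop :=
  Generated (fun X p =>
    p = pair (cVar i) t ∨
    (∃ j, j ≠ i ∧ p = pair (cVar j) (cVar j)) ∨
    p = pair cZero cZero ∨ p = pair cOne cOne ∨
    (∃ u u', pair u u' ∈ X ∧ p = pair (cSucc u) (cSucc u')) ∨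
    (∃ u u' w w', pair u u' ∈ X ∧ pair w w' ∈ X ∧
      (p = pair (cAdd u w) (cAdd u' w') ∨ p = pair (cMul u w) (cMul u' w')))) (pair u u')

/-- `φ'` results from the formula `φ` by substituting the closed term `t` for the free
occurrences of the `i`-th variable. -/
def SubstForm (i t φ φ' : M) : Prop :=
  Generated (fun X p =>
    (∃ u u' w w', SubstTerm i t u u' ∧ SubstTerm i t w w' ∧
      (p = pair (cEq u w) (cEq u' w') ∨ p = pair (cLe u w) (cLe u' w'))) ∨
    (∃ φ φ', pair φ φ' ∈ X ∧ p = pair (cNeg φ) (cNeg φ')) ∨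
    (∃ φ φ' ψ ψ', pair φ φ' ∈ X ∧ pair ψ ψ' ∈ X ∧
      (p = pair (cAnd φ ψ) (cAnd φ' ψ') ∨ p = pair (cOr φ ψ) (cOr φ' ψ'))) ∨
    (∃ j φ φ', j ≠ i ∧ pair φ φ' ∈ X ∧
      (p = pair (cEx j φ) (cEx j φ') ∨ p = pair (cAll j φ) (cAll j φ'))) ∨
    (∃ φ, IsForm φ ∧
      (p = pair (cEx i φ) (cEx i φ) ∨ p = pair (cAll i φ) (cAll i φ)))) (pair φ φ')

/-! ### Standard formulae and their codes -/

/-- Standard arithmetical terms, with variables `v₀, v₁, …`. -/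
inductive ATerm : Type
  | var (i : ℕ)
  | zero
  | one
  | succ (t : ATerm)
  | add (t s : ATerm)
  | mul (t s : ATerm)

/-- Standard arithmetical formulae. -/
inductive AForm : Type
  | eq (t s : ATerm)
  | le (t s : ATerm)
  | neg (φ : AForm)
  | and (φ ψ : AForm)
  | or (φ ψ : AForm)
  | ex (i : ℕ) (φ : AForm)
  | all (i : ℕ) (φ : AForm)

/-- The value of a standard term under the assignment `v`. -/
def ATerm.eval (v : ℕ → M) : ATerm → M
  | .var i => v i
  | .zero => 0
  | .one => 1
  | .succ t => sc (t.eval v)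
  | .add t s => t.eval v + s.eval v
  | .mul t s => t.eval v * s.eval v

/-- Satisfaction of a standard formula in `M` under the assignment `v`. -/
def AForm.Sat : (ℕ → M) → AForm → Prop
  | v, .eq t s => t.eval v = s.eval v
  | v, .le t s => t.eval v ≤ s.eval v
  | v, .neg φ => ¬ φ.Sat v
  | v, .and φ ψ => φ.Sat v ∧ ψ.Sat v
  | v, .or φ ψ => φ.Sat v ∨ ψ.Sat v
  | v, .ex i φ => ∃ x : M, φ.Sat (Function.update v i x)
  | v, .all i φ => ∀ x : M, φ.Sat (Function.update v i x)

/-- The code in `M` of the result of substituting in a standard term, for each `i`, the term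
with code `t i` for the variable `vᵢ`. -/
def ATerm.code (t : ℕ → M) : ATerm → M
  | .var i => t i
  | .zero => cZero
  | .one => cOne
  | .succ s => cSucc (s.code t)
  | .add s r => cAdd (s.code t) (r.code t)
  | .mul s r => cMul (s.code t) (r.code t)

/-- The code in `M` of `ψ(t₀, t₁, …)`: the closed terms with codes `t i` are substituted
simultaneously for the free occurrences of the variables `vᵢ` in the standard formula `ψ`. -/
def AForm.code : (ℕ → M) → AForm → M
  | t, .eq s r => cEq (s.code t) (r.code t)
  | t, .le s r => cLe (s.code t) (r.code t)
  | t, .neg φ => cNeg (φ.code t)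
  | t, .and φ ψ => cAnd (φ.code t) (ψ.code t)
  | t, .or φ ψ => cOr (φ.code t) (ψ.code t)
  | t, .ex i φ => cEx (std i) (φ.code (Function.update t i (cVar (std i))))
  | t, .all i φ => cAll (std i) (φ.code (Function.update t i (cVar (std i))))

/-! ### The compositional theory of truth -/

/-- `T(x)` holds in the expansion `(M, T)`. -/
def Tr [LPred.Structure M] (x : M) : Prop :=
  Structure.RelMap (L := LPred) UnaryRel.pred ![x]

variable (M) in
/-- `(M, T) ⊨ CT⁻`: `M` is a model of Peano arithmetic (induction for arithmetical formulae only)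
and `T` is compositional for all arithmetical sentences in the sense of `M`. -/
structure ModelsCTMinus [LPred.Structure M] : Prop where
  models_PA : M ⊨ PA
  eq_iff : ∀ t s x y : M, IsClTerm t → IsClTerm s → HasValue t x → HasValue s y →
    (Tr (cEq t s) ↔ x = y)
  le_iff : ∀ t s x y : M, IsClTerm t → IsClTerm s → HasValue t x → HasValue s y →
    (Tr (cLe t s) ↔ x ≤ y)
  neg_iff : ∀ φ : M, IsSent φ → (Tr (cNeg φ) ↔ ¬ Tr φ)
  and_iff : ∀ φ ψ : M, IsSent φ → IsSent ψ → (Tr (cAnd φ ψ) ↔ Tr φ ∧ Tr ψ)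
  or_iff : ∀ φ ψ : M, IsSent φ → IsSent ψ → (Tr (cOr φ ψ) ↔ Tr φ ∨ Tr ψ)
  ex_iff : ∀ i φ : M, IsSent (cEx i φ) →
    (Tr (cEx i φ) ↔ ∃ t φ' : M, IsClTerm t ∧ SubstForm i t φ φ' ∧ Tr φ')
  all_iff : ∀ i φ : M, IsSent (cAll i φ) →
    (Tr (cAll i φ) ↔ ∀ t φ' : M, IsClTerm t → SubstForm i t φ φ' → Tr φ')

/-- The uniform disquotation scheme for a formula `T'(x)` of `LPAT` with parameters from `M`:
`T' ψ(t₀, t₁, …) ≡ ψ(t₀°, t₁°, …)` for all standard arithmetical formulae `ψ` and all closed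
terms `t₀, t₁, …` in the sense of `M`. -/
def UniformDisquotation [LPred.Structure M] (T' : LPAT[[M]].Formula (Fin 1)) : Prop :=
  ∀ (ψ : AForm) (t x : ℕ → M), (∀ i, IsClTerm (t i)) → (∀ i, HasValue (t i) (x i)) →
    (T'.Realize (fun _ => ψ.code t) ↔ ψ.Sat x)

end Operations

end CTPaper

open CTPaper

/-! The predicate sought is `Ev β`: truth, according to `T`, of the instances of a possibly
nonstandard formula `β` with one free variable. It suffices that `Ev β` satisfies `δ` and obeys the
Tarskian clauses on all formulae of standard depth; disquotation then follows by external induction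
on `ψ` (`AForm.disquotation`).

Suppose that no `Good` code `β` has these properties. Then every such `β` has a rank, the least
standard `r` with `Fails δ (Ev β) (std r)`. A predicate without failure up to `r` is `partialTruth
r`: it is defined by a standard formula, so it satisfies `δ` by hypothesis, and it is compositional
up to depth `r` inclusive. One arithmetical operation `β ↦ β'`, uniform in `r`, yields it. Let
`D_{m+1}(x, y)` say that `β` does not fail at `y` and that `x` follows by the compositional clauses
from `D_m(·, y + 1)`. For nonstandard `c`, the evaluation of `D_c(x, 0)` runs through `y = 0, 1, …`
and stops with falsity at the first failure `y = r`, long before `D_0` matters; so `D_c(x, 0)`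
expresses `partialTruth r` (`IsIteration.ev_iff`). With `β'(x) := D_c(x, 0)` the rank strictly
increases.

The operation on codes does not mention `T`, so `M` can iterate it `c` times by arithmetical
induction alone (`exists_iterate`). By external induction, a term of the sequence with at least `i +
1` predecessors has no failure at any `n ≤ i`. As `c` is nonstandard, the last term fails at no
standard number, a contradiction (`exists_good`). Induction for formulae containing `T` is never
needed.

The supporting facts are Gödel's `β` in a model of `PA` (`exists_beta_code`), the fixed-point
property of inductively generated sets (`generated_unfold`), and the computation of `T` on a
standard formula into which arbitrary codes are plugged for predicates (`tr_code_iff`,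
`ev_wrap_iff`). -/

namespace CTPaper

/-! ### Formulae with de Bruijn indices, and definability -/

/-- Terms with de Bruijn variables and constants from `C`. -/
inductive Tm (C : Type*) : Type _
  | var (i : ℕ)
  | const (c : C)
  | zero
  | succ (t : Tm C)
  | add (t s : Tm C)
  | mul (t s : Tm C)

/-- Arithmetical formulae with de Bruijn variables, constants from `C` and further unary
predicates indexed by `ι`. -/
inductive PF (ι C : Type*) : Type _
  | eq (t s : Tm C)
  | neg (φ : PF ι C)
  | and (φ ψ : PF ι C)
  | ex (φ : PF ι C)
  | pred (i : ι) (t : Tm C)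

/-- Extend an assignment by a value for the variable `0`. -/
def cons {M : Type*} (x : M) (v : ℕ → M) : ℕ → M
  | 0 => x
  | n + 1 => v n

/-- Simultaneous substitution in terms. -/
def Tm.subst {C : Type*} (σ : ℕ → Tm C) : Tm C → Tm C
  | .var i => σ i
  | .const c => .const c
  | .zero => .zero
  | .succ t => .succ (t.subst σ)
  | .add t s => .add (t.subst σ) (s.subst σ)
  | .mul t s => .mul (t.subst σ) (s.subst σ)

/-- Simultaneous substitution in formulae. -/
def PF.subst {ι C : Type*} : (ℕ → Tm C) → PF ι C → PF ι C
  | σ, .eq t s => .eq (t.subst σ) (s.subst σ)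
  | σ, .neg φ => .neg (φ.subst σ)
  | σ, .and φ ψ => .and (φ.subst σ) (ψ.subst σ)
  | σ, .ex φ => .ex (φ.subst (cons (.var 0) fun i => (σ i).subst fun j => .var (j + 1)))
  | σ, .pred i t => .pred i (t.subst σ)

section Definability

variable {M : Type u} [LPA.Structure M]

attribute [local instance] zeroInst oneInst addInst mulInst leInst

variable {ι C : Type*}

/-- The value of a term. -/
def Tm.eval (κ : C → M) (v : ℕ → M) : Tm C → M
  | .var i => v i
  | .const c => κ c
  | .zero => 0
  | .succ t => sc (t.eval κ v)
  | .add t s => t.eval κ v + s.eval κ v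
  | .mul t s => t.eval κ v * s.eval κ v

/-- Satisfaction of a formula. -/
def PF.Sat (κ : C → M) (P : ι → M → Prop) : (ℕ → M) → PF ι C → Prop
  | v, .eq t s => t.eval κ v = s.eval κ v
  | v, .neg φ => ¬ φ.Sat κ P v
  | v, .and φ ψ => φ.Sat κ P v ∧ ψ.Sat κ P v
  | v, .ex φ => ∃ x : M, φ.Sat κ P (cons x v)
  | v, .pred i t => P i (t.eval κ v)

theorem Tm.eval_subst (κ : C → M) (v : ℕ → M) (σ : ℕ → Tm C) (t : Tm C) :
    (t.subst σ).eval κ v = t.eval κ fun i => (σ i).eval κ v := by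
  induction t with
  | var i => rfl
  | const c => rfl
  | zero => rfl
  | succ t ih => simp only [Tm.subst, Tm.eval, ih]
  | add t s iht ihs => simp only [Tm.subst, Tm.eval, iht, ihs]
  | mul t s iht ihs => simp only [Tm.subst, Tm.eval, iht, ihs]

theorem PF.sat_subst (κ : C → M) (P : ι → M → Prop) (φ : PF ι C) : ∀ (v : ℕ → M) (σ : ℕ → Tm C),
    (φ.subst σ).Sat κ P v ↔ φ.Sat κ P fun i => (σ i).eval κ v := by
  induction φ with
  | eq t s => intro v σ; simp only [PF.subst, PF.Sat, Tm.eval_subst]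
  | neg φ ih => intro v σ; simp only [PF.subst, PF.Sat, ih]
  | and φ ψ ih₁ ih₂ => intro v σ; simp only [PF.subst, PF.Sat, ih₁, ih₂]
  | ex φ ih =>
    intro v σ
    simp only [PF.subst, PF.Sat, ih]
    refine exists_congr fun x => ?_
    have : (fun i => Tm.eval κ (cons x v)
        (cons (.var 0) (fun i => (σ i).subst fun j => .var (j + 1)) i)) =
        cons x fun i => (σ i).eval κ v := by
      funext i
      cases i with
      | zero => rfl
      | succ i => simp only [cons, Tm.eval_subst, Tm.eval]
    rw [this]
  | pred i t => intro v σ; simp only [PF.subst, PF.Sat, Tm.eval_subst]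

/-- `f` is the value of a term with constants interpreted by `κ`. -/
class TDef (κ : C → M) (f : (ℕ → M) → M) : Prop where
  exists_tm : ∃ t : Tm C, ∀ v, t.eval κ v = f v

/-- `R` is defined by a formula with constants interpreted by `κ`, uniformly in the interpretation
of the predicates. -/
class Def (κ : C → M) (R : (ι → M → Prop) → (ℕ → M) → Prop) : Prop where
  exists_pf : ∃ ψ : PF ι C, ∀ P v, ψ.Sat κ P v ↔ R P v

/-- Definability in `M` with parameters. -/
abbrev DefM (R : (ℕ → M) → Prop) : Prop :=
  Def (ι := Empty) (id : M → M) fun _ v => R v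

variable {κ : C → M}

instance TDef.var (i : ℕ) : TDef κ fun v => v i := ⟨.var i, fun _ => rfl⟩
instance TDef.const (a : M) : TDef (id : M → M) fun _ => a := ⟨.const a, fun _ => rfl⟩
instance TDef.zero : TDef κ fun _ => (0 : M) := ⟨.zero, fun _ => rfl⟩

instance TDef.succ (f : (ℕ → M) → M) [hf : TDef κ f] : TDef κ fun v => sc (f v) := by
  obtain ⟨t, ht⟩ := hf
  exact ⟨.succ t, fun v => by simp only [Tm.eval, ht]⟩

instance TDef.add (f g : (ℕ → M) → M) [hf : TDef κ f] [hg : TDef κ g] :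
    TDef κ fun v => f v + g v := by
  obtain ⟨t, ht⟩ := hf
  obtain ⟨s, hs⟩ := hg
  exact ⟨.add t s, fun v => by simp only [Tm.eval, ht, hs]⟩

instance TDef.mul (f g : (ℕ → M) → M) [hf : TDef κ f] [hg : TDef κ g] :
    TDef κ fun v => f v * g v := by
  obtain ⟨t, ht⟩ := hf
  obtain ⟨s, hs⟩ := hg
  exact ⟨.mul t s, fun v => by simp only [Tm.eval, ht, hs]⟩

instance TDef.std (n : ℕ) : TDef κ fun _ => (CTPaper.std n : M) := by
  induction n with
  | zero => exact TDef.zero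
  | succ n ih => exact TDef.succ _

/-- Terms may be read in a larger context. -/
instance TDef.ren (f : (ℕ → M) → M) [hf : TDef κ f] (σ : ℕ → ℕ) :
    TDef κ fun v => f fun i => v (σ i) := by
  obtain ⟨t, ht⟩ := hf
  exact ⟨t.subst fun i => .var (σ i), fun v => by rw [Tm.eval_subst, ht]; rfl⟩

instance TDef.pair (f g : (ℕ → M) → M) [TDef κ f] [TDef κ g] :
    TDef κ fun v => CTPaper.pair (f v) (g v) := by
  unfold CTPaper.pair; infer_instance

variable {p q : (ι → M → Prop) → (ℕ → M) → Prop}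

instance Def.eq (f g : (ℕ → M) → M) [hf : TDef κ f] [hg : TDef κ g] :
    Def (ι := ι) κ fun _ v => f v = g v := by
  obtain ⟨t, ht⟩ := hf
  obtain ⟨s, hs⟩ := hg
  exact ⟨.eq t s, fun P v => by simp only [PF.Sat, ht, hs]⟩

instance Def.not [hp : Def κ p] : Def κ fun P v => ¬ p P v := by
  obtain ⟨φ, hφ⟩ := hp
  exact ⟨.neg φ, fun P v => by simp only [PF.Sat, hφ]⟩

instance Def.and [hp : Def κ p] [hq : Def κ q] : Def κ fun P v => p P v ∧ q P v := by
  obtain ⟨φ, hφ⟩ := hp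
  obtain ⟨ψ, hψ⟩ := hq
  exact ⟨.and φ ψ, fun P v => by simp only [PF.Sat, hφ, hψ]⟩

/-- The bound variable takes index `0` and the others shift by one, so instance search descends
through a predicate and assembles its formula. Because the formula does not depend on `P`, the same
one may later be read with `Ev` or with `partialTruth` for its predicates. -/
instance Def.ex (R : (ι → M → Prop) → (ℕ → M) → M → Prop)
    [h : Def κ fun P w => R P (fun i => w (i + 1)) (w 0)] :
    Def κ fun P v => ∃ x, R P v x := by
  obtain ⟨φ, hφ⟩ := h
  exact ⟨.ex φ, fun P v => by simp only [PF.Sat, hφ]; rfl⟩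

instance Def.pred (i : ι) (f : (ℕ → M) → M) [hf : TDef κ f] : Def κ fun P v => P i (f v) := by
  obtain ⟨t, ht⟩ := hf
  exact ⟨.pred i t, fun P v => by simp only [PF.Sat, ht]⟩

theorem Def.congr (hp : Def κ p) (h : ∀ P v, q P v ↔ p P v) : Def κ q := by
  have : q = p := by funext P v; exact propext (h P v)
  rwa [this]

instance Def.or [Def κ p] [Def κ q] : Def κ fun P v => p P v ∨ q P v :=
  Def.congr (inferInstance : Def κ fun P v => ¬ (¬ p P v ∧ ¬ q P v)) fun P v => by tauto

instance Def.imp [Def κ p] [Def κ q] : Def κ fun P v => p P v → q P v :=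
  Def.congr (inferInstance : Def κ fun P v => ¬ (p P v ∧ ¬ q P v)) fun P v => by tauto

instance Def.iff [Def κ p] [Def κ q] : Def κ fun P v => p P v ↔ q P v :=
  Def.congr (inferInstance : Def κ fun P v => (p P v → q P v) ∧ (q P v → p P v))
    fun P v => by tauto

instance Def.all (R : (ι → M → Prop) → (ℕ → M) → M → Prop)
    [h : Def κ fun P w => R P (fun i => w (i + 1)) (w 0)] :
    Def κ fun P v => ∀ x, R P v x :=
  Def.congr (inferInstance : Def κ fun P v => ¬ ∃ x, ¬ R P v x) fun P v => by push Not; rfl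

instance Def.false : Def (ι := ι) κ fun _ _ => False :=
  Def.congr (inferInstance : Def κ fun _ _ => ¬ (0 : M) = 0) fun P v => by simp

instance Def.ne (f g : (ℕ → M) → M) [hf : TDef κ f] [hg : TDef κ g] :
    Def (ι := ι) κ fun _ v => f v ≠ g v :=
  Def.not

theorem Def.subst (hp : Def κ p) (g : ℕ → (ℕ → M) → M) (hg : ∀ i, TDef κ (g i)) :
    Def κ fun P v => p P fun i => g i v := by
  obtain ⟨φ, hφ⟩ := hp
  choose t ht using fun i => (hg i).exists_tm
  exact ⟨φ.subst t, fun P v => by simp only [PF.sat_subst, ht, hφ]⟩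

/-- Turns the definability of an abstract `Q` into a local instance for its occurrences at arbitrary
terms, as needed when `Q` sits inside an induction formula. -/
theorem DefM.comp {Q : M → Prop} (hQ : DefM fun v => Q (v 0)) (g : (ℕ → M) → M)
    [hg : TDef (id : M → M) g] : DefM fun v => Q (g v) :=
  Def.subst hQ (fun _ => g) fun _ => hg

theorem DefM.comp₂ {Q : M → M → Prop} (hQ : DefM fun v => Q (v 0) (v 1)) (f g : (ℕ → M) → M)
    [hf : TDef (id : M → M) f] [hg : TDef (id : M → M) g] : DefM fun v => Q (f v) (g v) :=
  Def.subst hQ (fun i => if i = 0 then f else g) fun i => by split <;> assumption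

/-! ### Translation to first-order formulae, and induction -/

section Translation

variable {L' : Language} [L'.Structure M]

theorem funMap_zero (v : Fin 0 → M) :
    Structure.funMap (L := LPA) ArithFunc.zero v = (0 : M) :=
  congrArg _ (Subsingleton.elim _ _)

theorem funMap_one (v : Fin 0 → M) :
    Structure.funMap (L := LPA) ArithFunc.one v = (1 : M) :=
  congrArg _ (Subsingleton.elim _ _)

theorem funMap_succ (v : Fin 1 → M) :
    Structure.funMap (L := LPA) ArithFunc.succ v = sc (v 0) :=
  congrArg _ (funext fun i => by fin_cases i; rfl)

theorem funMap_add (v : Fin 2 → M) :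
    Structure.funMap (L := LPA) ArithFunc.add v = v 0 + v 1 :=
  congrArg _ (funext fun i => by fin_cases i <;> rfl)

theorem funMap_mul (v : Fin 2 → M) :
    Structure.funMap (L := LPA) ArithFunc.mul v = v 0 * v 1 :=
  congrArg _ (funext fun i => by fin_cases i <;> rfl)

theorem relMap_le (v : Fin 2 → M) :
    Structure.RelMap (L := LPA) ArithRel.le v ↔ v 0 ≤ v 1 := by
  have : v = ![v 0, v 1] := funext fun i => by fin_cases i <;> rfl
  rw [this]; rfl

theorem realize_func_onFunction (e : LPA →ᴸ L') [e.IsExpansionOn M] {α : Type*} {n : ℕ}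
    (f : LPA.Functions n) (ts : Fin n → L'.Term α) (v : α → M) :
    (Term.func (e.onFunction f) ts).realize v =
      Structure.funMap f fun i => (ts i).realize v :=
  e.map_onFunction f _

/-- Every term with constants is a term of any expansion, the constants being read as variables. -/
theorem Tm.exists_term (e : LPA →ᴸ L') [e.IsExpansionOn M] (t : Tm C) :
    ∃ s : L'.Term (C ⊕ ℕ), ∀ (κ : C → M) (v : ℕ → M), s.realize (Sum.elim κ v) = t.eval κ v := by
  induction t with
  | var i => exact ⟨.var (.inr i), fun _ _ => rfl⟩
  | const c => exact ⟨.var (.inl c), fun _ _ => rfl⟩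
  | zero =>
    exact ⟨.func (e.onFunction (ArithFunc.zero : LPA.Functions 0)) ![], fun κ v =>
      (realize_func_onFunction e _ _ _).trans (funMap_zero _)⟩
  | succ t ih =>
    obtain ⟨s, hs⟩ := ih
    exact ⟨.func (e.onFunction (ArithFunc.succ : LPA.Functions 1)) ![s], fun κ v =>
      (realize_func_onFunction e _ _ _).trans ((funMap_succ _).trans (congrArg sc (hs κ v)))⟩
  | add t t' ih ih' =>
    obtain ⟨s, hs⟩ := ih
    obtain ⟨s', hs'⟩ := ih'
    exact ⟨.func (e.onFunction (ArithFunc.add : LPA.Functions 2)) ![s, s'], fun κ v =>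
      (realize_func_onFunction e _ _ _).trans
        ((funMap_add _).trans (congrArg₂ (· + ·) (hs κ v) (hs' κ v)))⟩
  | mul t t' ih ih' =>
    obtain ⟨s, hs⟩ := ih
    obtain ⟨s', hs'⟩ := ih'
    exact ⟨.func (e.onFunction (ArithFunc.mul : LPA.Functions 2)) ![s, s'], fun κ v =>
      (realize_func_onFunction e _ _ _).trans
        ((funMap_mul _).trans (congrArg₂ (· * ·) (hs κ v) (hs' κ v)))⟩

/-- Constants become free variables, so one formula serves all their interpretations; predicates are
replaced by formulae defining them in `L'`. -/
theorem PF.exists_formula (e : LPA →ᴸ L') [e.IsExpansionOn M] (P : ι → M → Prop)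
    (hP : ∀ i, ∃ φ : L'.Formula (Fin 1), ∀ x : M, φ.Realize (fun _ => x) ↔ P i x) (ψ : PF ι C) :
    ∃ φ : L'.Formula (C ⊕ ℕ), ∀ (κ : C → M) (v : ℕ → M),
      φ.Realize (Sum.elim κ v) ↔ ψ.Sat κ P v := by
  induction ψ with
  | eq t s =>
    obtain ⟨t', ht⟩ := t.exists_term (M := M) e
    obtain ⟨s', hs⟩ := s.exists_term (M := M) e
    exact ⟨t'.equal s', fun κ v => by rw [Formula.realize_equal, ht, hs]; rfl⟩
  | neg φ ih =>
    obtain ⟨φ', h⟩ := ih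
    exact ⟨φ'.not, fun κ v => by rw [Formula.realize_not, h]; rfl⟩
  | and φ ψ ih₁ ih₂ =>
    obtain ⟨φ', h⟩ := ih₁
    obtain ⟨ψ', h'⟩ := ih₂
    exact ⟨φ' ⊓ ψ', fun κ v => by rw [Formula.realize_inf, h, h']; rfl⟩
  | ex φ ih =>
    obtain ⟨φ', h⟩ := ih
    let g : C ⊕ ℕ → (C ⊕ ℕ) ⊕ Unit :=
      Sum.elim (fun c => .inl (.inl c)) (fun n => n.casesOn (.inr ()) fun n => .inl (.inr n))
    refine ⟨(φ'.relabel g).iExs Unit, fun κ v => ?_⟩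
    have hg : ∀ x : Unit → M, Sum.elim (Sum.elim κ v) x ∘ g = Sum.elim κ (cons (x ()) v) := by
      intro x
      funext y
      rcases y with c | n
      · rfl
      · cases n <;> rfl
    rw [Formula.realize_iExs]
    simp only [Formula.realize_relabel, hg, h, PF.Sat]
    exact ⟨fun ⟨x, hx⟩ => ⟨x (), hx⟩, fun ⟨x, hx⟩ => ⟨fun _ => x, hx⟩⟩
  | pred i t =>
    obtain ⟨t', ht⟩ := t.exists_term (M := M) e
    obtain ⟨φ, hφ⟩ := hP i
    refine ⟨BoundedFormula.subst φ fun _ => t', fun κ v => ?_⟩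
    rw [Formula.Realize, BoundedFormula.realize_subst]
    simp only [ht]
    exact hφ _

end Translation

/-- Only finitely many parameters occur in a formula; listing them puts it into the shape required
by the induction scheme. -/
theorem exists_formula_parameters (φ : LPA.Formula (M ⊕ Unit)) :
    ∃ (n : ℕ) (φ' : LPA.Formula ((Empty ⊕ Fin n) ⊕ Unit)) (a : Fin n → M), ∀ x : M,
      φ'.Realize (Sum.elim (Sum.elim Empty.elim a) fun _ => x) ↔
        φ.Realize (Sum.elim id fun _ => x) := by
  classical
  let s := BoundedFormula.freeVarFinset φ
  let g : s → (Empty ⊕ Fin s.card) ⊕ Unit := fun y =>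
    Sum.elim (fun _ => .inl (.inr (s.equivFin y))) (fun u => .inr u) y.1
  refine ⟨s.card, BoundedFormula.restrictFreeVar φ g,
    fun i => Sum.elim id (fun _ => 0) (s.equivFin.symm i).1, fun x => ?_⟩
  refine BoundedFormula.realize_restrictFreeVar (f := g) _ ?_
  rintro ⟨m | u, hm⟩
  · simp [g]
  · rfl

/-- Induction in `M` for definable properties. -/
theorem ind (hM : M ⊨ PA) (Q : M → Prop) (hQ : DefM fun v => Q (v 0)) (h0 : Q 0)
    (hs : ∀ x, Q x → Q (sc x)) (x : M) : Q x := by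
  obtain ⟨ψ, hψ⟩ := hQ
  obtain ⟨φ, hφ⟩ := ψ.exists_formula (LHom.id LPA) (M := M) (fun i => i.elim) (fun i => i.elim)
  obtain ⟨n, φ', a, h⟩ := exists_formula_parameters
    (φ.relabel (Sum.map id fun _ => () : M ⊕ ℕ → M ⊕ Unit))
  have hQ' : ∀ x, φ'.Realize (Sum.elim (Sum.elim Empty.elim a) fun _ => x) ↔ Q x := by
    intro x
    rw [h, Formula.realize_relabel, Sum.elim_comp_map, Function.comp_id]
    exact (hφ id fun _ => x).trans (hψ _ _)
  have hax := hM.realize_of_mem _ (PA.induction φ')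
  simp only [inductionAxiom, Sentence.Realize, Formula.realize_iAlls, Formula.realize_imp,
    Formula.realize_inf] at hax
  have e0 : (fun y => Sum.elim (default : Empty → M) a y) = Sum.elim Empty.elim a := by
    funext y; rcases y with y | y
    · exact y.elim
    · rfl
  have hax := hax a
  rw [e0] at hax
  refine (hQ' x).1 (hax ⟨?_, fun i => ?_⟩ fun _ => x)
  · have e1 : (fun y => (Sum.elim Term.var (fun _ => tZero) y : LPA.Term _).realize
        (Sum.elim Empty.elim a)) = Sum.elim (Sum.elim Empty.elim a) fun _ : Unit => (0 : M) := by
      funext y; rcases y with y | y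
      · rfl
      · exact funMap_zero _
    rw [Formula.Realize, BoundedFormula.realize_subst, e1]
    exact (hQ' 0).2 h0
  · intro hi
    have e1 : (fun y => (Sum.elim (fun p => Term.var (Sum.inl p))
        (fun x => tSucc (Term.var (Sum.inr x))) y : LPA.Term _).realize
        fun y => Sum.elim (Sum.elim Empty.elim a) i y) =
        Sum.elim (Sum.elim Empty.elim a) fun _ : Unit => sc (i ()) := by
      funext y; rcases y with y | y
      · rfl
      · exact funMap_succ _
    rw [Formula.Realize, BoundedFormula.realize_subst, e1]
    exact (hQ' _).2 (hs _ ((hQ' (i ())).1 hi))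

end Definability

/-! ### Arithmetic in a model of `PA` -/

section Arithmetic

section Axioms

variable {M : Type u} [LPA.Structure M]

attribute [local instance] zeroInst oneInst addInst mulInst leInst

variable {α : Type*} (v : α → M)

theorem realize_tZero : (tZero : LPA.Term α).realize v = 0 := funMap_zero _
theorem realize_tOne : (tOne : LPA.Term α).realize v = 1 := funMap_one _
theorem realize_tSucc (t : LPA.Term α) : (tSucc t).realize v = sc (t.realize v) := funMap_succ _
theorem realize_tAdd (t s : LPA.Term α) :
    (tAdd t s).realize v = t.realize v + s.realize v := funMap_add _
theorem realize_tMul (t s : LPA.Term α) :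
    (tMul t s).realize v = t.realize v * s.realize v := funMap_mul _
theorem realize_fLe {n : ℕ} (t s : LPA.Term (α ⊕ Fin n)) (xs : Fin n → M) :
    (fLe t s).Realize v xs ↔ t.realize (Sum.elim v xs) ≤ s.realize (Sum.elim v xs) := relMap_le _

variable (hM : M ⊨ PA)
include hM

theorem one_eq_sc : (1 : M) = sc 0 := by
  have := hM.realize_of_mem _ PA.one_eq
  simpa [Sentence.Realize, Formula.Realize, realize_tOne, realize_tSucc, realize_tZero] using this

theorem sc_ne_zero (x : M) : sc x ≠ 0 := by
  have := hM.realize_of_mem _ PA.succ_ne_zero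
  simp [Sentence.Realize, Formula.Realize, realize_tSucc, realize_tZero] at this
  exact this x

theorem sc_inj {x y : M} (h : sc x = sc y) : x = y := by
  have := hM.realize_of_mem _ PA.succ_inj
  simp [Sentence.Realize, Formula.Realize, realize_tSucc, Fin.snoc] at this
  exact this x y h

theorem add_zero_ax (x : M) : x + 0 = x := by
  have := hM.realize_of_mem _ PA.add_zero
  simp [Sentence.Realize, Formula.Realize, realize_tAdd, realize_tZero, Fin.snoc] at this
  exact this x

theorem add_sc (x y : M) : x + sc y = sc (x + y) := by
  have := hM.realize_of_mem _ PA.add_succ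
  simp [Sentence.Realize, Formula.Realize, realize_tAdd, realize_tSucc, Fin.snoc] at this
  exact this x y

theorem mul_zero_ax (x : M) : x * 0 = 0 := by
  have := hM.realize_of_mem _ PA.mul_zero
  simp [Sentence.Realize, Formula.Realize, realize_tMul, realize_tZero, Fin.snoc] at this
  exact this x

theorem mul_sc (x y : M) : x * sc y = x * y + x := by
  have := hM.realize_of_mem _ PA.mul_succ
  simp [Sentence.Realize, Formula.Realize, realize_tMul, realize_tAdd, realize_tSucc,
    Fin.snoc] at this
  exact this x y

theorem le_iff_exists_add_ax (x y : M) : x ≤ y ↔ ∃ z, x + z = y := by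
  have := hM.realize_of_mem _ PA.le_iff
  simp [Sentence.Realize, Formula.Realize, realize_fLe, realize_tAdd, Fin.snoc] at this
  exact this x y

theorem zero_add_ax (x : M) : 0 + x = x :=
  ind hM (fun x => 0 + x = x) inferInstance (add_zero_ax hM 0)
    (fun x h => by rw [add_sc hM, h]) x

theorem sc_add (x y : M) : sc x + y = sc (x + y) :=
  ind hM (fun y => sc x + y = sc (x + y)) inferInstance
    (by rw [add_zero_ax hM, add_zero_ax hM]) (fun y h => by rw [add_sc hM, add_sc hM, h]) y

theorem add_comm_ax (x y : M) : x + y = y + x :=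
  ind hM (fun y => x + y = y + x) inferInstance
    (by rw [add_zero_ax hM, zero_add_ax hM]) (fun y h => by rw [add_sc hM, sc_add hM, h]) y

theorem add_assoc_ax (x y z : M) : x + y + z = x + (y + z) :=
  ind hM (fun z => x + y + z = x + (y + z)) inferInstance
    (by rw [add_zero_ax hM, add_zero_ax hM]) (fun z h => by simp only [add_sc hM, h]) z

theorem zero_mul_ax (x : M) : 0 * x = 0 :=
  ind hM (fun x => 0 * x = 0) inferInstance (mul_zero_ax hM 0)
    (fun x h => by rw [mul_sc hM, h, add_zero_ax hM]) x

theorem mul_add_ax (x y z : M) : x * (y + z) = x * y + x * z :=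
  ind hM (fun z => x * (y + z) = x * y + x * z) inferInstance
    (by rw [mul_zero_ax hM, add_zero_ax hM, add_zero_ax hM])
    (fun z h => by rw [add_sc hM, mul_sc hM, mul_sc hM, h, add_assoc_ax hM]) z

theorem sc_mul (x y : M) : sc x * y = x * y + y :=
  ind hM (fun y => sc x * y = x * y + y) inferInstance
    (by rw [mul_zero_ax hM, mul_zero_ax hM, add_zero_ax hM])
    (fun y h => by
      rw [mul_sc hM, mul_sc hM, h, add_sc hM, add_sc hM, add_assoc_ax hM, add_assoc_ax hM,
        add_comm_ax hM y x]) y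

theorem mul_comm_ax (x y : M) : x * y = y * x :=
  ind hM (fun y => x * y = y * x) inferInstance
    (by rw [mul_zero_ax hM, zero_mul_ax hM]) (fun y h => by rw [mul_sc hM, sc_mul hM, h]) y

theorem mul_assoc_ax (x y z : M) : x * y * z = x * (y * z) :=
  ind hM (fun z => x * y * z = x * (y * z)) inferInstance
    (by simp only [mul_zero_ax hM]) (fun z h => by rw [mul_sc hM, mul_sc hM, mul_add_ax hM, h]) z

theorem mul_one_ax (x : M) : x * 1 = x := by
  rw [one_eq_sc hM, mul_sc hM, mul_zero_ax hM, zero_add_ax hM]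

theorem add_right_cancel_ax {x y z : M} (h : x + z = y + z) : x = y :=
  ind hM (fun z => x + z = y + z → x = y) inferInstance
    (fun h => by rwa [add_zero_ax hM, add_zero_ax hM] at h)
    (fun z ih h => ih (sc_inj hM (by rwa [add_sc hM, add_sc hM] at h))) z h

theorem eq_zero_or_eq_sc (x : M) : x = 0 ∨ ∃ y, x = sc y :=
  ind hM (fun x => x = 0 ∨ ∃ y, x = sc y) inferInstance (Or.inl rfl)
    (fun x _ => Or.inr ⟨x, rfl⟩) x

theorem eq_zero_of_add_eq_zero {x y : M} (h : x + y = 0) : x = 0 := by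
  rcases eq_zero_or_eq_sc hM x with rfl | ⟨z, rfl⟩
  · rfl
  · rw [sc_add hM] at h
    exact absurd h (sc_ne_zero hM _)

theorem le_total_ax (x y : M) : x ≤ y ∨ y ≤ x := by
  simp only [le_iff_exists_add_ax hM]
  refine ind hM (fun x => (∃ z, x + z = y) ∨ ∃ z, y + z = x) inferInstance
    (Or.inl ⟨y, zero_add_ax hM y⟩) ?_ x
  rintro x (⟨z, hz⟩ | ⟨z, hz⟩)
  · rcases eq_zero_or_eq_sc hM z with rfl | ⟨w, rfl⟩
    · right; exact ⟨sc 0, by rw [← hz, add_zero_ax hM, add_sc hM, add_zero_ax hM]⟩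
    · left; exact ⟨w, by rw [← hz, sc_add hM, add_sc hM]⟩
  · right; exact ⟨sc z, by rw [← hz, add_sc hM]⟩

end Axioms

/-! ### The ordered semiring structure of a model of `PA`. -/

variable {M : Type u} [LPA.Structure M] [hM : Fact (M ⊨ PA)]

instance : CommSemiring M where
  toZero := zeroInst
  toOne := oneInst
  toAdd := addInst
  toMul := mulInst
  add_assoc := add_assoc_ax hM.out
  zero_add := zero_add_ax hM.out
  add_zero := add_zero_ax hM.out
  add_comm := add_comm_ax hM.out
  nsmul := @nsmulRec M zeroInst addInst
  left_distrib := mul_add_ax hM.out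
  right_distrib x y z := by
    rw [mul_comm_ax hM.out, mul_add_ax hM.out, mul_comm_ax hM.out z, mul_comm_ax hM.out z]
  zero_mul := zero_mul_ax hM.out
  mul_zero := mul_zero_ax hM.out
  mul_assoc := mul_assoc_ax hM.out
  one_mul x := by rw [mul_comm_ax hM.out, mul_one_ax hM.out]
  mul_one := mul_one_ax hM.out
  mul_comm := mul_comm_ax hM.out
  natCast n := @Nat.unaryCast M oneInst zeroInst addInst n
  npow := @npowRec M oneInst mulInst

instance : IsCancelAdd M where
  add_left_cancel x y z h := add_right_cancel_ax hM.out (z := x) (by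
    rw [add_comm_ax hM.out y, add_comm_ax hM.out z]; exact h)
  add_right_cancel x y z h := add_right_cancel_ax hM.out h

noncomputable instance : LinearOrder M where
  toLE := leInst
  le_refl x := (le_iff_exists_add_ax hM.out _ _).2 ⟨0, add_zero x⟩
  le_trans x y z h h' := by
    obtain ⟨a, rfl⟩ := (le_iff_exists_add_ax hM.out _ _).1 h
    obtain ⟨b, rfl⟩ := (le_iff_exists_add_ax hM.out _ _).1 h'
    exact (le_iff_exists_add_ax hM.out _ _).2 ⟨a + b, (add_assoc x a b).symm⟩
  le_antisymm x y h h' := by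
    obtain ⟨a, ha⟩ := (le_iff_exists_add_ax hM.out _ _).1 h
    obtain ⟨b, hb⟩ := (le_iff_exists_add_ax hM.out _ _).1 h'
    have : x + (a + b) = x := by rw [← add_assoc]; exact (congrArg (· + b) ha).trans hb
    have := eq_zero_of_add_eq_zero hM.out (add_eq_left.1 this)
    rw [← ha, this]; exact (add_zero x).symm
  le_total := le_total_ax hM.out
  toDecidableLE := Classical.decRel _

theorem sc_eq_add_one (x : M) : sc x = x + 1 := by
  have : x + sc 0 = sc (x + 0) := add_sc hM.out x 0
  rw [← one_eq_sc hM.out, add_zero] at this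
  exact this.symm

theorem le_iff_exists_add' {x y : M} : x ≤ y ↔ ∃ z, y = x + z :=
  (le_iff_exists_add_ax hM.out x y).trans (exists_congr fun _ => eq_comm)

instance : CanonicallyOrderedAdd M where
  exists_add_of_le := fun h => le_iff_exists_add'.1 h
  le_add_self _ y := le_iff_exists_add'.2 ⟨y, add_comm _ _⟩
  le_self_add _ y := le_iff_exists_add'.2 ⟨y, rfl⟩

instance : Nontrivial M :=
  ⟨⟨1, 0, by rw [show (1 : M) = sc 0 from one_eq_sc hM.out]; exact sc_ne_zero hM.out _⟩⟩

theorem lt_iff_add_one_le {x y : M} : x < y ↔ x + 1 ≤ y := by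
  constructor
  · intro h
    obtain ⟨z, rfl⟩ := le_iff_exists_add'.1 h.le
    rcases eq_zero_or_eq_sc hM.out z with hz | ⟨w, rfl⟩
    · rw [show z = 0 from hz, add_zero] at h; exact absurd h (lt_irrefl _)
    · exact le_iff_exists_add'.2 ⟨w, by rw [sc_eq_add_one]; ring⟩
  · intro h
    obtain ⟨z, rfl⟩ := le_iff_exists_add'.1 h
    refine lt_of_le_of_ne (le_iff_exists_add'.2 ⟨1 + z, by ring⟩) fun h => ?_
    have : (1 : M) + z = 0 := add_eq_left (a := x).1 (by rw [← add_assoc]; exact h.symm)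
    exact one_ne_zero (eq_zero_of_add_eq_zero hM.out this)

instance : IsOrderedAddMonoid M where
  add_le_add_left x y h z := by
    obtain ⟨w, rfl⟩ := le_iff_exists_add'.1 h
    exact le_iff_exists_add'.2 ⟨w, by ring⟩

instance : IsOrderedCancelAddMonoid M where
  le_of_add_le_add_left x y z h := by
    obtain ⟨w, hw⟩ := le_iff_exists_add'.1 h
    exact le_iff_exists_add'.2 ⟨w, add_left_cancel (a := x) (by rw [hw]; ring)⟩

theorem mul_lt_mul_left_ax {x y z : M} (hz : 0 < z) (h : x < y) : z * x < z * y := by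
  rw [lt_iff_add_one_le] at *
  rw [zero_add] at hz
  obtain ⟨a, rfl⟩ := le_iff_exists_add'.1 hz
  obtain ⟨b, rfl⟩ := le_iff_exists_add'.1 h
  exact le_iff_exists_add'.2 ⟨b + a + a * b, by ring⟩

instance : IsStrictOrderedRing M where
  zero_le_one := zero_le
  mul_lt_mul_of_pos_left _ hz _ _ h := mul_lt_mul_left_ax hz h
  mul_lt_mul_of_pos_right z hz x y h := by
    simp only [mul_comm _ z]; exact mul_lt_mul_left_ax hz h

end Arithmetic

/-! ### Coding of sequences -/

section Coding

variable {M : Type u} [LPA.Structure M] [hM : Fact (M ⊨ PA)]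

theorem induct (Q : M → Prop) (hQ : DefM fun v => Q (v 0)) (h0 : Q 0)
    (hs : ∀ x, Q x → Q (x + 1)) (x : M) : Q x :=
  ind hM.out Q hQ h0 (fun x h => by rw [sc_eq_add_one]; exact hs x h) x

section Instances

variable {ι C : Type*} {κ : C → M}

instance TDef.one : TDef κ fun _ => (1 : M) := by
  rw [show (1 : M) = sc 0 from one_eq_sc hM.out]
  exact TDef.succ (fun _ => 0)

instance Def.le (f g : (ℕ → M) → M) [TDef κ f] [TDef κ g] :
    Def (ι := ι) κ fun _ v => f v ≤ g v :=
  Def.congr (inferInstance : Def κ fun _ v => ∃ z, g v = f v + z) fun _ _ => le_iff_exists_add'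

instance Def.lt (f g : (ℕ → M) → M) [TDef κ f] [TDef κ g] :
    Def (ι := ι) κ fun _ v => f v < g v :=
  Def.congr (inferInstance : Def κ fun _ v => ¬ g v ≤ f v) fun _ _ => not_le.symm

instance Def.beta (f₁ f₂ f₃ f₄ : (ℕ → M) → M) [TDef κ f₁] [TDef κ f₂] [TDef κ f₃] [TDef κ f₄] :
    Def (ι := ι) κ fun _ v => Beta (f₁ v) (f₂ v) (f₃ v) (f₄ v) := by
  unfold Beta; infer_instance

end Instances

theorem lt_add_one_iff' {x y : M} : x < y + 1 ↔ x ≤ y := by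
  rw [lt_iff_add_one_le, add_le_add_iff_right]

theorem add_one_pos' (x : M) : 0 < x + 1 := lt_add_one_iff'.2 zero_le

/-- With `s = x + y`, the value `s² + x` lies between `s²` and `s² + s`, hence below `(s + 1)²`. The
witness is the explicit difference. -/
theorem pair_lt_pair {x y x' y' : M} (h : x + y < x' + y') : pair x y < pair x' y' := by
  rw [lt_iff_add_one_le] at h ⊢
  obtain ⟨w, hw⟩ := le_iff_exists_add'.1 h
  refine le_iff_exists_add'.2 ⟨x + 2 * y + w ^ 2 + 2 * w + 2 * (x + y) * w + x', ?_⟩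
  change (x' + y') * (x' + y') + x' = (x + y) * (x + y) + x + 1 + _
  rw [hw]; ring

@[simp] theorem pair_inj {x y x' y' : M} : pair x y = pair x' y' ↔ x = x' ∧ y = y' := by
  refine ⟨fun h => ?_, by rintro ⟨rfl, rfl⟩; rfl⟩
  rcases lt_trichotomy (x + y) (x' + y') with h' | h' | h'
  · exact absurd h (pair_lt_pair h').ne
  · have hx : x = x' := by
      have : (x + y) * (x + y) + x = (x' + y') * (x' + y') + x' := h
      rw [h'] at this
      exact add_left_cancel this
    subst hx
    exact ⟨rfl, add_left_cancel h'⟩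
  · exact absurd h (pair_lt_pair h').ne'

theorem std_succ (n : ℕ) : (std (n + 1) : M) = std n + 1 := sc_eq_add_one _

theorem std_eq_natCast (n : ℕ) : (std n : M) = n := by
  induction n with
  | zero => exact Nat.cast_zero.symm
  | succ n ih => rw [std_succ, ih, Nat.cast_succ]

@[simp] theorem std_inj {m n : ℕ} : (std m : M) = std n ↔ m = n := by
  rw [std_eq_natCast, std_eq_natCast, Nat.cast_inj]

theorem eq_std_of_lt {x : M} {n : ℕ} (h : x < std n) : ∃ m < n, x = std m := by
  induction n with
  | zero => exact absurd h (not_lt.2 zero_le)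
  | succ n ih =>
    rw [std_succ, lt_add_one_iff'] at h
    rcases h.lt_or_eq with h | h
    · obtain ⟨m, hm, rfl⟩ := ih h
      exact ⟨m, hm.trans n.lt_succ_self, rfl⟩
    · exact ⟨n, n.lt_succ_self, h⟩

theorem exists_div (a : M) {m : M} (hm : 0 < m) : ∃ q r, a = q * m + r ∧ r < m := by
  refine induct (fun a => ∃ q r, a = q * m + r ∧ r < m) inferInstance ⟨0, 0, by ring, hm⟩ ?_ a
  rintro a ⟨q, r, rfl, hr⟩
  rcases (lt_iff_add_one_le.1 hr).lt_or_eq with h | h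
  · exact ⟨q, r + 1, by ring, h⟩
  · exact ⟨q + 1, 0, by rw [← h]; ring, hm⟩

theorem div_quotient_le {q q' m r r' : M} (h : q * m + r = q' * m + r') (hr : r < m) : q' ≤ q := by
  by_contra hq
  obtain ⟨w, rfl⟩ := le_iff_exists_add'.1 (lt_iff_add_one_le.1 (not_le.1 hq))
  have : r = m + (w * m + r') := add_left_cancel (a := q * m) (by rw [h]; ring)
  rw [this] at hr
  exact absurd hr (not_lt.2 (le_iff_exists_add'.2 ⟨_, rfl⟩))

theorem remainder_unique {q q' m r r' : M} (h : q * m + r = q' * m + r') (hr : r < m)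
    (hr' : r' < m) : r = r' := by
  have := le_antisymm (div_quotient_le h hr) (div_quotient_le h.symm hr')
  subst this
  exact add_left_cancel h

theorem beta_iff {a b i y : M} :
    Beta a b i y ↔ (∃ q, a = q * ((i + 1) * b + 1) + y) ∧ y < (i + 1) * b + 1 := by
  unfold Beta
  simp only [sc_eq_add_one, lt_add_one_iff']
  exact ⟨fun ⟨q, h, h'⟩ => ⟨⟨q, h⟩, h'⟩, fun ⟨⟨q, h⟩, h'⟩ => ⟨q, h, h'⟩⟩

theorem Beta.unique {a b i y y' : M} (h : Beta a b i y) (h' : Beta a b i y') : y = y' := by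
  obtain ⟨⟨q, hq⟩, hy⟩ := beta_iff.1 h
  obtain ⟨⟨q', hq'⟩, hy'⟩ := beta_iff.1 h'
  exact remainder_unique (hq.symm.trans hq') hy hy'

theorem exists_beta_value (a b i : M) : ∃ y, Beta a b i y := by
  obtain ⟨q, r, h, hr⟩ := exists_div a (add_one_pos' ((i + 1) * b))
  exact ⟨r, beta_iff.2 ⟨⟨q, h⟩, hr⟩⟩

/-- A one-sided form of Bézout's identity, for which no negative numbers are needed. -/
def Cop (x m : M) : Prop := ∃ u w, u * x = w * m + 1

theorem Cop.mul {x y m : M} (hx : Cop x m) (hy : Cop y m) : Cop (x * y) m := by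
  obtain ⟨u, w, h⟩ := hx
  obtain ⟨u', w', h'⟩ := hy
  refine ⟨u * u', w * w' * m + w + w', ?_⟩
  calc u * u' * (x * y) = (u * x) * (u' * y) := by ring
    _ = _ := by rw [h, h']; ring

/-- With `x`, `m` the two moduli, `(i + d + 1) x - (i + 1) m = d`; hence `b = e d` and then `1 = x -
(i + 1) b` are combinations of `x` and `m`. The negative coefficient of `x` is made positive by `(i
+ d + 1) b ≡ -1` modulo `m`. -/
theorem cop_moduli {b i d e : M} (hb : b = e * d) :
    Cop ((i + 1) * b + 1) ((i + d + 1) * b + 1) := by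
  refine ⟨1 + (i + 1) * e * (i + d + 1) * ((i + d + 1) * b),
    (i + 1) * e * (d + (i + d + 1) * (i + 1) * b), ?_⟩
  subst hb; ring

/-- This is `k!`. Since factorials cannot be defined before sequences are coded, induction is on the
mere existence of a common multiple. -/
theorem exists_common_multiple (k : M) :
    ∃ b : M, 0 < b ∧ ∀ d, 0 < d → d ≤ k → ∃ e, b = e * d := by
  refine induct (fun k => ∃ b : M, 0 < b ∧ ∀ d, 0 < d → d ≤ k → ∃ e, b = e * d)
    inferInstance ⟨1, one_pos, fun d h h' => absurd h (not_lt.2 h')⟩ ?_ k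
  rintro k ⟨b, hb, h⟩
  refine ⟨b * (k + 1), mul_pos hb (add_one_pos' k), fun d hd hdk => ?_⟩
  rcases hdk.lt_or_eq with hdk | rfl
  · obtain ⟨e, rfl⟩ := h d hd (lt_add_one_iff'.1 hdk)
    exact ⟨e * (k + 1), by ring⟩
  · exact ⟨b, rfl⟩

/-! ### The Chinese remainder theorem and definable finite functions. -/

section Comprehension

variable {f : M → M → Prop} (hf : DefM fun v => f (v 0) (v 1)) {n : M}
include hf

theorem exists_bound (hun : ∀ i y y', f i y → f i y' → y = y') :
    ∃ B : M, ∀ i < n, ∀ y, f i y → y ≤ B := by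
  have (g h : (ℕ → M) → M) [TDef (id : M → M) g] [TDef (id : M → M) h] :
    DefM fun v => f (g v) (h v) := hf.comp₂ g h
  refine induct (fun n => ∃ B : M, ∀ i, i < n → ∀ y, f i y → y ≤ B) inferInstance
    ⟨0, fun i hi => absurd hi (not_lt.2 zero_le)⟩ ?_ n
  rintro k ⟨B, h⟩
  by_cases hk : ∃ y, f k y
  · obtain ⟨y₀, hy₀⟩ := hk
    refine ⟨B + y₀, fun i hi y hy => ?_⟩
    rcases (lt_add_one_iff'.1 hi).lt_or_eq with hi | rfl
    · exact (h i hi y hy).trans le_self_add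
    · rw [hun _ _ _ hy hy₀]; exact le_add_self
  · refine ⟨B, fun i hi y hy => ?_⟩
    rcases (lt_add_one_iff'.1 hi).lt_or_eq with hi | rfl
    · exact h i hi y hy
    · exact absurd ⟨y, hy⟩ hk

/-- Induction on the number `k` of congruences solved. The auxiliary `p` is a common multiple of the
moduli used so far that remains coprime to the later ones, so corrections by multiples of `p`
preserve what is solved. -/
theorem exists_chinese_remainder (hex : ∀ i < n, ∃ y, f i y)
    (hun : ∀ i y y', f i y → f i y' → y = y') {b : M}
    (hb : ∀ i j, i < j → j < n → Cop ((i + 1) * b + 1) ((j + 1) * b + 1)) :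
    ∃ a : M, ∀ i < n, ∀ y, f i y → ∃ q, a = q * ((i + 1) * b + 1) + y := by
  have (g h : (ℕ → M) → M) [TDef (id : M → M) g] [TDef (id : M → M) h] :
    DefM fun v => f (g v) (h v) := hf.comp₂ g h
  suffices h : ∀ k, k ≤ n → ∃ a p : M,
      (∀ i, i < k → ∀ y, f i y → ∃ q, a = q * ((i + 1) * b + 1) + y) ∧
      (∀ i, i < k → ∃ q, p = q * ((i + 1) * b + 1)) ∧
      ∀ i, k ≤ i → i < n → Cop p ((i + 1) * b + 1) by
    obtain ⟨a, p, h, -⟩ := h n le_rfl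
    exact ⟨a, h⟩
  unfold Cop at hb ⊢
  refine induct _ inferInstance ?_ ?_
  · exact fun _ => ⟨0, 1, fun i hi => absurd hi (not_lt.2 zero_le),
      fun i hi => absurd hi (not_lt.2 zero_le), fun i _ _ => ⟨1, 0, by ring⟩⟩
  · intro k ih hk
    have hkn : k < n := lt_iff_add_one_le.2 hk
    obtain ⟨a, p, ha, hp, hc⟩ := ih hkn.le
    obtain ⟨y₀, hy₀⟩ := hex k hkn
    obtain ⟨u, w, huw⟩ := hc k le_rfl hkn
    -- Modulo `(k + 1) * b + 1` one has `p * u ≡ 1` and `(k + 1) * b ≡ -1`, so the new value is `a +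
    -- y₀ - a = y₀`, without subtraction.
    refine ⟨a + p * u * (y₀ + (k + 1) * b * a), p * ((k + 1) * b + 1), ?_, ?_, ?_⟩
    · intro i hi y hy
      rcases (lt_add_one_iff'.1 hi).lt_or_eq with hi | rfl
      · obtain ⟨q, hq⟩ := ha i hi y hy
        obtain ⟨q', hq'⟩ := hp i hi
        refine ⟨q + q' * u * (y₀ + (k + 1) * b * a), ?_⟩
        calc _ = (q * ((i + 1) * b + 1) + y) +
              q' * ((i + 1) * b + 1) * u * (y₀ + (k + 1) * b * a) := by rw [← hq', ← hq]
          _ = _ := by ring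
      · rw [hun _ _ _ hy hy₀]
        refine ⟨a + w * (y₀ + (i + 1) * b * a), ?_⟩
        calc _ = a + (u * p) * (y₀ + (i + 1) * b * a) := by ring
          _ = _ := by rw [huw]; ring
    · intro i hi
      rcases (lt_add_one_iff'.1 hi).lt_or_eq with hi | rfl
      · obtain ⟨q', hq'⟩ := hp i hi
        exact ⟨q' * ((k + 1) * b + 1), by rw [hq']; ring⟩
      · exact ⟨p, rfl⟩
    · intro i hi hin
      have hki : k < i := lt_iff_add_one_le.2 hi
      exact Cop.mul (hc i hki.le hin) (hb k i hki hin)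

/-- Every finite definable function is coded by Gödel's `β`. -/
theorem exists_beta_code (hex : ∀ i < n, ∃ y, f i y)
    (hun : ∀ i y y', f i y → f i y' → y = y') :
    ∃ a b : M, ∀ i < n, ∀ y, Beta a b i y ↔ f i y := by
  obtain ⟨B, hB⟩ := exists_bound hf (n := n) hun
  -- This `b` does two things: it is at least `B`, so all entries are below their moduli, and it is
  -- divisible by all differences of indices, so the moduli are coprime.
  obtain ⟨b, hb, hdiv⟩ := exists_common_multiple (n + B + 1)
  have hBb : B ≤ b := by
    obtain ⟨e, rfl⟩ := hdiv _ (add_one_pos' _) le_rfl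
    rcases eq_or_ne e 0 with rfl | he
    · rw [zero_mul] at hb; exact absurd hb (lt_irrefl _)
    · obtain ⟨e, rfl⟩ := le_iff_exists_add'.1 (lt_iff_add_one_le.1 (pos_iff_ne_zero.2 he))
      exact le_iff_exists_add'.2 ⟨n + 1 + e * (n + B + 1), by ring⟩
  obtain ⟨a, ha⟩ := exists_chinese_remainder hf hex hun (b := b) (by
    intro i j hij hjn
    obtain ⟨d, rfl⟩ := le_iff_exists_add'.1 hij.le
    have hd : 0 < d := by
      rcases eq_or_ne d 0 with rfl | hd
      · rw [add_zero] at hij; exact absurd hij (lt_irrefl _)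
      · exact pos_iff_ne_zero.2 hd
    obtain ⟨e, he⟩ := hdiv d hd
      ((le_add_self.trans hjn.le).trans (le_iff_exists_add'.2 ⟨B + 1, by ring⟩))
    exact cop_moduli he)
  have key : ∀ i < n, ∀ y, f i y → Beta a b i y := by
    intro i hi y hy
    refine beta_iff.2 ⟨ha i hi y hy, lt_add_one_iff'.2 (((hB i hi y hy).trans hBb).trans ?_)⟩
    exact le_iff_exists_add'.2 ⟨i * b, by ring⟩
  refine ⟨a, b, fun i hi y => ⟨fun h => ?_, key i hi y⟩⟩
  obtain ⟨y₀, hy₀⟩ := hex i hi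
  rwa [h.unique (key i hi y₀ hy₀)]

end Comprehension

/-- Append an entry to a coded sequence. -/
theorem exists_append (a b n x : M) : ∃ a' b' : M,
    (∀ i < n, ∀ y, Beta a' b' i y ↔ Beta a b i y) ∧ ∀ y, Beta a' b' n y ↔ y = x := by
  obtain ⟨a', b', h⟩ := exists_beta_code
    (f := fun i y => (i < n ∧ Beta a b i y) ∨ (i = n ∧ y = x)) inferInstance (n := n + 1)
    (fun i hi => by
      rcases (lt_add_one_iff'.1 hi).lt_or_eq with hi | rfl
      · obtain ⟨y, hy⟩ := exists_beta_value a b i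
        exact ⟨y, .inl ⟨hi, hy⟩⟩
      · exact ⟨x, .inr ⟨rfl, rfl⟩⟩)
    (by
      rintro i y y' (⟨hi, h⟩ | ⟨rfl, rfl⟩) (⟨hi', h'⟩ | ⟨h, rfl⟩)
      · exact h.unique h'
      · exact absurd h hi.ne
      · exact absurd hi' (lt_irrefl _)
      · rfl)
  refine ⟨a', b', fun i hi y => ?_, fun y => ?_⟩
  · rw [h i (hi.trans (lt_add_one_iff'.2 le_rfl)) y]
    simp [hi, hi.ne]
  · rw [h n (lt_add_one_iff'.2 le_rfl) y]
    simp

/-- Concatenate two coded sequences. -/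
theorem exists_concat (a₁ b₁ n₁ a₂ b₂ n₂ : M) : ∃ a b : M,
    (∀ i < n₁, ∀ y, Beta a b i y ↔ Beta a₁ b₁ i y) ∧
      ∀ i < n₂, ∀ y, Beta a b (n₁ + i) y ↔ Beta a₂ b₂ i y := by
  obtain ⟨a, b, h⟩ := exists_beta_code
    (f := fun i y => (i < n₁ ∧ Beta a₁ b₁ i y) ∨ ∃ j, i = n₁ + j ∧ Beta a₂ b₂ j y)
    inferInstance (n := n₁ + n₂)
    (fun i hi => by
      rcases lt_or_ge i n₁ with hi | hi
      · obtain ⟨y, hy⟩ := exists_beta_value a₁ b₁ i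
        exact ⟨y, .inl ⟨hi, hy⟩⟩
      · obtain ⟨j, rfl⟩ := le_iff_exists_add'.1 hi
        obtain ⟨y, hy⟩ := exists_beta_value a₂ b₂ j
        exact ⟨y, .inr ⟨j, rfl, hy⟩⟩)
    (by
      rintro i y y' (⟨hi, h⟩ | ⟨j, rfl, h⟩) (⟨hi', h'⟩ | ⟨j', hj, h'⟩)
      · exact h.unique h'
      · exact absurd (hj ▸ hi) (not_lt.2 le_self_add)
      · exact absurd hi' (not_lt.2 le_self_add)
      · obtain rfl := add_left_cancel hj
        exact h.unique h')
  refine ⟨a, b, fun i hi y => ?_, fun i hi y => ?_⟩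
  · rw [h i (hi.trans_le le_self_add) y]
    refine ⟨?_, fun h => .inl ⟨hi, h⟩⟩
    rintro (⟨-, h⟩ | ⟨j, rfl, -⟩)
    · exact h
    · exact absurd hi (not_lt.2 le_self_add)
  · rw [h _ (by gcongr) y]
    refine ⟨?_, fun h => .inr ⟨i, rfl, h⟩⟩
    rintro (⟨hi, -⟩ | ⟨j, hj, h⟩)
    · exact absurd hi (not_lt.2 le_self_add)
    · rwa [add_left_cancel hj]

/-! ### Recursion and inductive generation inside `M` -/

/-- Definable dependent choice along an initial segment of `M`. -/
theorem exists_iterate {S : M → M → Prop} (hS : DefM fun v => S (v 0) (v 1)) {I : M → Prop}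
    (hI : DefM fun v => I (v 0)) {x₀ : M} (h₀ : I x₀) (hstep : ∀ x, I x → ∃ y, I y ∧ S x y)
    (n : M) : ∃ a b : M, Beta a b 0 x₀ ∧ (∀ i, i ≤ n → ∀ x, Beta a b i x → I x) ∧
      ∀ i, i < n → ∀ x y, Beta a b i x → Beta a b (i + 1) y → S x y := by
  have (g h : (ℕ → M) → M) [TDef (id : M → M) g] [TDef (id : M → M) h] :
    DefM fun v => S (g v) (h v) := hS.comp₂ g h
  have (g : (ℕ → M) → M) [TDef (id : M → M) g] : DefM fun v => I (g v) := hI.comp g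
  refine induct (fun n => ∃ a b : M, Beta a b 0 x₀ ∧ (∀ i, i ≤ n → ∀ x, Beta a b i x → I x) ∧
    ∀ i, i < n → ∀ x y, Beta a b i x → Beta a b (i + 1) y → S x y) inferInstance ?_ ?_ n
  · obtain ⟨a, b, -, h⟩ := exists_append (0 : M) 0 0 x₀
    refine ⟨a, b, (h _).2 rfl, fun i hi x hx => ?_, fun i hi => absurd hi (not_lt.2 zero_le)⟩
    obtain rfl : i = 0 := le_antisymm hi zero_le
    rwa [(h x).1 hx]
  · rintro n ⟨a, b, hz, hinv, hs⟩
    obtain ⟨x, hx⟩ := exists_beta_value a b n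
    obtain ⟨y, hy, hxy⟩ := hstep x (hinv n le_rfl x hx)
    obtain ⟨a', b', h, h'⟩ := exists_append a b (n + 1) y
    refine ⟨a', b', (h 0 (add_one_pos' n) _).2 hz, fun i hi z hz => ?_, fun i hi z w hz hw => ?_⟩
    · rcases hi.lt_or_eq with hi | rfl
      · exact hinv i (lt_add_one_iff'.1 hi) z ((h i hi z).1 hz)
      · rwa [(h' z).1 hz]
    · rw [h i hi] at hz
      rcases (lt_add_one_iff'.1 hi).lt_or_eq with hi | rfl
      · rw [h (i + 1) (by gcongr)] at hw
        exact hs i hi z w hz hw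
      · rw [(h' w).1 hw, hz.unique hx]
        exact hxy

/-- All entries below `n` of the sequence coded by `a, b` are obtained by `Step`. -/
def GenSeq (Step : Set M → M → Prop) (a b n : M) : Prop :=
  ∀ i y : M, i < n → Beta a b i y → Step {z | ∃ j : M, j < i ∧ Beta a b j z} y

theorem generated_iff {Step : Set M → M → Prop} {x : M} :
    Generated Step x ↔ ∃ a b n : M, Beta a b n x ∧ GenSeq Step a b (n + 1) := by
  simp only [Generated, GenSeq, sc_eq_add_one, ← lt_iff_add_one_le, lt_add_one_iff']

theorem GenSeq.generated {Step : Set M → M → Prop} {a b n i y : M} (h : GenSeq Step a b n)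
    (hi : i < n) (hy : Beta a b i y) : Generated Step y :=
  generated_iff.2 ⟨a, b, i, hy, fun j z hj hz =>
    h j z ((lt_add_one_iff'.1 hj).trans_lt hi) hz⟩

/-- `A` is monotone and finitary. -/
class FinMono (A : Set M → Prop) : Prop where
  mono : ∀ {X Y : Set M}, X ⊆ Y → A X → A Y
  fin : ∀ {X : Set M}, A X → ∃ s : Finset M, (s : Set M) ⊆ X ∧ A s

instance FinMono.const (p : Prop) : FinMono fun _ : Set M => p where
  mono _ h := h
  fin h := ⟨∅, by simp, h⟩

instance FinMono.mem (t : M) : FinMono fun X => t ∈ X where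
  mono h h' := h h'
  fin h := ⟨{t}, by simpa using h, by simp⟩

instance FinMono.and {A B : Set M → Prop} [hA : FinMono A] [hB : FinMono B] :
    FinMono fun X => A X ∧ B X where
  mono h h' := ⟨hA.mono h h'.1, hB.mono h h'.2⟩
  fin h := by
    obtain ⟨s, hs, h₁⟩ := hA.fin h.1
    obtain ⟨t, ht, h₂⟩ := hB.fin h.2
    refine ⟨s ∪ t, by simp [hs, ht], hA.mono ?_ h₁, hB.mono ?_ h₂⟩ <;> simp

instance FinMono.or {A B : Set M → Prop} [hA : FinMono A] [hB : FinMono B] :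
    FinMono fun X => A X ∨ B X where
  mono h := Or.imp (hA.mono h) (hB.mono h)
  fin h := by
    rcases h with h | h
    · obtain ⟨s, hs, h⟩ := hA.fin h
      exact ⟨s, hs, .inl h⟩
    · obtain ⟨s, hs, h⟩ := hB.fin h
      exact ⟨s, hs, .inr h⟩

instance FinMono.ex {A : M → Set M → Prop} [hA : ∀ x, FinMono (A x)] :
    FinMono fun X => ∃ x, A x X where
  mono h := fun ⟨x, h'⟩ => ⟨x, (hA x).mono h h'⟩
  fin := by
    rintro X ⟨x, h⟩
    obtain ⟨s, hs, h⟩ := (hA x).fin h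
    exact ⟨s, hs, x, h⟩

variable {Step : Set M → M → Prop} [hStep : ∀ y, FinMono fun X => Step X y]
include hStep

theorem Generated.inversion {x : M} (h : Generated Step x) : Step {z | Generated Step z} x := by
  obtain ⟨a, b, n, hx, h⟩ := generated_iff.1 h
  refine (hStep _).mono ?_ (h n x (lt_add_one_iff'.2 le_rfl) hx)
  rintro z ⟨j, hj, hz⟩
  exact h.generated (hj.trans (lt_add_one_iff'.2 le_rfl)) hz

/-- Course-of-values induction, inside `M`, on positions in a generating sequence whose length may
be nonstandard; this is why `Q` has to be definable. -/
theorem Generated.induction (Q : M → Prop) (hQ : DefM fun v => Q (v 0))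
    (hs : ∀ y, Step {z | Generated Step z ∧ Q z} y → Q y) {x : M} (h : Generated Step x) : Q x := by
  have (g : (ℕ → M) → M) [TDef (id : M → M) g] : DefM fun v => Q (g v) := hQ.comp g
  obtain ⟨a, b, n, hx, h⟩ := generated_iff.1 h
  suffices H : ∀ k : M, ∀ i, i < k → i < n + 1 → ∀ y, Beta a b i y → Q y from
    H (n + 1) n (lt_add_one_iff'.2 le_rfl) (lt_add_one_iff'.2 le_rfl) x hx
  refine induct _ inferInstance (fun i hi => absurd hi (not_lt.2 zero_le)) ?_
  intro k ih i hi hin y hy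
  refine hs y ((hStep _).mono ?_ (h i y hin hy))
  rintro z ⟨j, hj, hz⟩
  have hjn := hj.trans hin
  exact ⟨h.generated hjn hz, ih j (hj.trans_le (lt_add_one_iff'.1 hi)) hjn z hz⟩

theorem GenSeq.append {a b n x : M} (h : GenSeq Step a b n)
    (hx : Step {z | ∃ j : M, j < n ∧ Beta a b j z} x) : Generated Step x := by
  obtain ⟨a', b', h₁, h₂⟩ := exists_append a b n x
  refine generated_iff.2 ⟨a', b', n, (h₂ x).2 rfl, fun i y hi hy => ?_⟩
  rcases (lt_add_one_iff'.1 hi).lt_or_eq with hi | rfl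
  · refine (hStep _).mono ?_ (h i y hi ((h₁ i hi y).1 hy))
    rintro z ⟨j, hj, hz⟩
    exact ⟨j, hj, (h₁ j (hj.trans hi) z).2 hz⟩
  · rw [(h₂ y).1 hy]
    refine (hStep _).mono ?_ hx
    rintro z ⟨j, hj, hz⟩
    exact ⟨j, hj, (h₁ j hj z).2 hz⟩

theorem GenSeq.concat {a₁ b₁ n₁ a₂ b₂ n₂ : M} (h₁ : GenSeq Step a₁ b₁ n₁)
    (h₂ : GenSeq Step a₂ b₂ n₂) : ∃ a b n : M, GenSeq Step a b n ∧
      (∀ i < n₁, ∀ y, Beta a₁ b₁ i y → ∃ j < n, Beta a b j y) ∧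
      ∀ i < n₂, ∀ y, Beta a₂ b₂ i y → ∃ j < n, Beta a b j y := by
  obtain ⟨a, b, e₁, e₂⟩ := exists_concat a₁ b₁ n₁ a₂ b₂ n₂
  refine ⟨a, b, n₁ + n₂, fun i y hi hy => ?_,
    fun i hi y hy => ⟨i, hi.trans_le le_self_add, (e₁ i hi y).2 hy⟩,
    fun i hi y hy => ⟨n₁ + i, by gcongr, (e₂ i hi y).2 hy⟩⟩
  rcases lt_or_ge i n₁ with hi' | hi'
  · refine (hStep _).mono ?_ (h₁ i y hi' ((e₁ i hi' y).1 hy))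
    rintro z ⟨j, hj, hz⟩
    exact ⟨j, hj, (e₁ j (hj.trans hi') z).2 hz⟩
  · obtain ⟨i, rfl⟩ := le_iff_exists_add'.1 hi'
    rw [add_lt_add_iff_left] at hi
    refine (hStep _).mono ?_ (h₂ i y hi ((e₂ i hi y).1 hy))
    rintro z ⟨j, hj, hz⟩
    exact ⟨n₁ + j, by gcongr, (e₂ j (hj.trans hi) z).2 hz⟩

/-- A concatenation of generating sequences is again one, so externally finitely many witnesses can
be merged. -/
theorem exists_genSeq (s : Finset M) (hs : ∀ z ∈ s, Generated Step z) :
    ∃ a b n : M, GenSeq Step a b n ∧ ∀ z ∈ s, ∃ j < n, Beta a b j z := by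
  classical
  induction s using Finset.induction_on with
  | empty => exact ⟨0, 0, 0, fun _ _ hi => absurd hi (not_lt.2 zero_le), by simp⟩
  | insert u s _ ih =>
    obtain ⟨a₁, b₁, n₁, h₁, h₁'⟩ := ih fun z hz => hs z (Finset.mem_insert_of_mem hz)
    obtain ⟨a₂, b₂, n₂, hu, h₂⟩ := generated_iff.1 (hs u (Finset.mem_insert_self _ _))
    obtain ⟨a, b, n, h, e₁, e₂⟩ := h₁.concat h₂
    refine ⟨a, b, n, h, fun z hz => ?_⟩
    rcases Finset.mem_insert.1 hz with rfl | hz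
    · exact e₂ n₂ (lt_add_one_iff'.2 le_rfl) z hu
    · obtain ⟨j, hj, hz⟩ := h₁' z hz
      exact e₁ j hj z hz

/-- The set generated by a monotone finitary step is a fixed point of it. -/
theorem generated_unfold {x : M} :
    Generated Step x ↔ Step {z | Generated Step z} x := by
  refine ⟨Generated.inversion, fun h => ?_⟩
  -- A step has only finitely many premises; one sequence contains them all, and `x` is appended to
  -- it.
  obtain ⟨s, hs, h⟩ := (hStep x).fin h
  obtain ⟨a, b, n, hab, h'⟩ := exists_genSeq s fun z hz => hs hz
  exact hab.append ((hStep x).mono (fun z hz => h' z hz) h)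

end Coding

/-! ### Terms and formulae inside `M` -/

section InternalTerms

variable {M : Type u} [LPA.Structure M] [hM : Fact (M ⊨ PA)]

/-! #### Terms -/

theorem isTerm_iff {y : M} : IsTerm y ↔
    (∃ i, y = cVar i) ∨ y = cZero ∨ y = cOne ∨
    (∃ t, IsTerm t ∧ y = cSucc t) ∨
    (∃ t, IsTerm t ∧ ∃ s, IsTerm s ∧ (y = cAdd t s ∨ y = cMul t s)) :=
  generated_unfold

theorem isTerm_var (i : M) : IsTerm (cVar i) := isTerm_iff.2 (.inl ⟨i, rfl⟩)
theorem isTerm_zero : IsTerm (cZero : M) := isTerm_iff.2 (by simp)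
theorem isTerm_one : IsTerm (cOne : M) := isTerm_iff.2 (by simp)
theorem isTerm_succ {t : M} (h : IsTerm t) : IsTerm (cSucc t) :=
  isTerm_iff.2 (.inr (.inr (.inr (.inl ⟨t, h, rfl⟩))))
theorem isTerm_add {t s : M} (h : IsTerm t) (h' : IsTerm s) : IsTerm (cAdd t s) :=
  isTerm_iff.2 (.inr (.inr (.inr (.inr ⟨t, h, s, h', .inl rfl⟩))))
theorem isTerm_mul {t s : M} (h : IsTerm t) (h' : IsTerm s) : IsTerm (cMul t s) :=
  isTerm_iff.2 (.inr (.inr (.inr (.inr ⟨t, h, s, h', .inr rfl⟩))))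

theorem isClTerm_iff {y : M} : IsClTerm y ↔
    y = cZero ∨ y = cOne ∨
    (∃ t, IsClTerm t ∧ y = cSucc t) ∨
    (∃ t, IsClTerm t ∧ ∃ s, IsClTerm s ∧ (y = cAdd t s ∨ y = cMul t s)) :=
  generated_unfold

theorem isClTerm_zero : IsClTerm (cZero : M) := isClTerm_iff.2 (by simp)
theorem isClTerm_one : IsClTerm (cOne : M) := isClTerm_iff.2 (by simp)
theorem isClTerm_succ {t : M} (h : IsClTerm t) : IsClTerm (cSucc t) :=
  isClTerm_iff.2 (.inr (.inr (.inl ⟨t, h, rfl⟩)))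
theorem isClTerm_add {t s : M} (h : IsClTerm t) (h' : IsClTerm s) : IsClTerm (cAdd t s) :=
  isClTerm_iff.2 (.inr (.inr (.inr ⟨t, h, s, h', .inl rfl⟩)))
theorem isClTerm_mul {t s : M} (h : IsClTerm t) (h' : IsClTerm s) : IsClTerm (cMul t s) :=
  isClTerm_iff.2 (.inr (.inr (.inr ⟨t, h, s, h', .inr rfl⟩)))

theorem IsClTerm.induction (Q : M → Prop) (hQ : DefM fun v => Q (v 0))
    (zero : Q cZero) (one : Q cOne) (succ : ∀ t, Q t → Q (cSucc t))
    (add : ∀ t s, Q t → Q s → Q (cAdd t s)) (mul : ∀ t s, Q t → Q s → Q (cMul t s)) {t : M}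
    (h : IsClTerm t) : Q t := by
  refine Generated.induction Q hQ ?_ h
  rintro y (rfl | rfl | ⟨t, ⟨-, ht⟩, rfl⟩ | ⟨t, ⟨-, ht⟩, s, ⟨-, hs⟩, rfl | rfl⟩)
  · exact zero
  · exact one
  · exact succ t ht
  · exact add t s ht hs
  · exact mul t s ht hs

section Instances

set_option synthInstance.maxSize 4000
set_option synthInstance.maxHeartbeats 400000

variable {ι C : Type*} {κ : C → M}

instance TDef.cVar (f : (ℕ → M) → M) [TDef κ f] : TDef κ fun v => cVar (f v) := by
  unfold CTPaper.cVar; infer_instance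
instance TDef.cZero : TDef κ fun _ => (cZero : M) := by
  unfold CTPaper.cZero; infer_instance
instance TDef.cOne : TDef κ fun _ => (cOne : M) := by
  unfold CTPaper.cOne; infer_instance
instance TDef.cSucc (f : (ℕ → M) → M) [TDef κ f] : TDef κ fun v => cSucc (f v) := by
  unfold CTPaper.cSucc; infer_instance
instance TDef.cNeg (f : (ℕ → M) → M) [TDef κ f] : TDef κ fun v => cNeg (f v) := by
  unfold CTPaper.cNeg; infer_instance

variable (f g : (ℕ → M) → M) [TDef κ f] [TDef κ g]

instance TDef.cAdd : TDef κ fun v => cAdd (f v) (g v) := by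
  unfold CTPaper.cAdd; infer_instance
instance TDef.cMul : TDef κ fun v => cMul (f v) (g v) := by
  unfold CTPaper.cMul; infer_instance
instance TDef.cEq : TDef κ fun v => cEq (f v) (g v) := by
  unfold CTPaper.cEq; infer_instance
instance TDef.cLe : TDef κ fun v => cLe (f v) (g v) := by
  unfold CTPaper.cLe; infer_instance
instance TDef.cAnd : TDef κ fun v => cAnd (f v) (g v) := by
  unfold CTPaper.cAnd; infer_instance
instance TDef.cOr : TDef κ fun v => cOr (f v) (g v) := by
  unfold CTPaper.cOr; infer_instance
instance TDef.cEx : TDef κ fun v => cEx (f v) (g v) := by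
  unfold CTPaper.cEx; infer_instance
instance TDef.cAll : TDef κ fun v => cAll (f v) (g v) := by
  unfold CTPaper.cAll; infer_instance

instance Def.isTerm : Def (ι := ι) κ fun _ v => IsTerm (f v) := by
  unfold IsTerm Generated; simp only [Set.mem_ofPred_eq]; infer_instance
instance Def.isClTerm : Def (ι := ι) κ fun _ v => IsClTerm (f v) := by
  unfold IsClTerm Generated; simp only [Set.mem_ofPred_eq]; infer_instance
instance Def.hasValue : Def (ι := ι) κ fun _ v => HasValue (f v) (g v) := by
  unfold HasValue Generated; simp only [Set.mem_ofPred_eq]; infer_instance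
instance Def.isForm : Def (ι := ι) κ fun _ v => IsForm (f v) := by
  unfold IsForm Generated; simp only [Set.mem_ofPred_eq]; infer_instance
instance Def.occursIn : Def (ι := ι) κ fun _ v => OccursIn (f v) (g v) := by
  unfold OccursIn Generated; simp only [Set.mem_ofPred_eq]; infer_instance
instance Def.freeIn : Def (ι := ι) κ fun _ v => FreeIn (f v) (g v) := by
  unfold FreeIn Generated; simp only [Set.mem_ofPred_eq]; infer_instance
instance Def.isSent : Def (ι := ι) κ fun _ v => IsSent (f v) := by
  unfold IsSent; infer_instance

variable (h k : (ℕ → M) → M) [TDef κ h] [TDef κ k]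

instance Def.substTerm : Def (ι := ι) κ fun _ v => SubstTerm (f v) (g v) (h v) (k v) := by
  unfold SubstTerm Generated; simp only [Set.mem_ofPred_eq]; infer_instance
instance Def.substForm : Def (ι := ι) κ fun _ v => SubstForm (f v) (g v) (h v) (k v) := by
  unfold SubstForm Generated; simp only [Set.mem_ofPred_eq]; infer_instance

end Instances

end InternalTerms
section InternalFormulae

variable {M : Type u} [LPA.Structure M] [hM : Fact (M ⊨ PA)]

/-! #### Values of closed terms -/

theorem hasValue_iff {t x : M} : HasValue t x ↔
    pair t x = pair cZero 0 ∨ pair t x = pair cOne 1 ∨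
    (∃ t' x', HasValue t' x' ∧ pair t x = pair (cSucc t') (sc x')) ∨
    (∃ t' x' s' y', HasValue t' x' ∧ HasValue s' y' ∧
      (pair t x = pair (cAdd t' s') (x' + y') ∨ pair t x = pair (cMul t' s') (x' * y'))) :=
  generated_unfold

theorem hasValue_zero {x : M} : HasValue cZero x ↔ x = 0 := by
  rw [hasValue_iff]; simp [cZero, cOne, cSucc, cAdd, cMul]

theorem hasValue_one {x : M} : HasValue cOne x ↔ x = 1 := by
  rw [hasValue_iff]; simp [cZero, cOne, cSucc, cAdd, cMul]

theorem hasValue_succ {t x : M} : HasValue (cSucc t) x ↔ ∃ y, HasValue t y ∧ x = sc y := by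
  rw [hasValue_iff]; simp [cZero, cOne, cSucc, cAdd, cMul]

theorem hasValue_add {t s x : M} :
    HasValue (cAdd t s) x ↔ ∃ y z, HasValue t y ∧ HasValue s z ∧ x = y + z := by
  rw [hasValue_iff]; simp [cZero, cOne, cSucc, cAdd, cMul]

theorem hasValue_mul {t s x : M} :
    HasValue (cMul t s) x ↔ ∃ y z, HasValue t y ∧ HasValue s z ∧ x = y * z := by
  rw [hasValue_iff]; simp [cZero, cOne, cSucc, cAdd, cMul]

/-- Existence and uniqueness must be proved by induction inside `M`, because closed terms may be
nonstandard. -/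
theorem IsClTerm.existsUnique_value {t : M} (h : IsClTerm t) :
    (∃ x, HasValue t x) ∧ ∀ x y, HasValue t x → HasValue t y → x = y := by
  refine IsClTerm.induction
    (fun t => (∃ x, HasValue t x) ∧ ∀ x y, HasValue t x → HasValue t y → x = y)
    inferInstance ?_ ?_ ?_ ?_ ?_ h
  · simp only [hasValue_zero]; grind
  · simp only [hasValue_one]; grind
  · simp only [hasValue_succ]; grind
  · simp only [hasValue_add]; grind
  · simp only [hasValue_mul]; grind

theorem IsClTerm.exists_value {t : M} (h : IsClTerm t) : ∃ x, HasValue t x :=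
  h.existsUnique_value.1

theorem IsClTerm.value_unique {t x y : M} (h : IsClTerm t) (hx : HasValue t x)
    (hy : HasValue t y) : x = y :=
  h.existsUnique_value.2 x y hx hy

/-- The numeral of `x`, possibly of nonstandard length. It is what makes quantification over closed
terms amount to quantification over `M`. -/
theorem exists_clTerm (x : M) : ∃ t, IsClTerm t ∧ HasValue t x := by
  refine induct (fun x => ∃ t, IsClTerm t ∧ HasValue t x) inferInstance
    ⟨cZero, isClTerm_zero, hasValue_zero.2 rfl⟩ ?_ x
  rintro x ⟨t, ht, hx⟩
  exact ⟨cSucc t, isClTerm_succ ht, hasValue_succ.2 ⟨x, hx, (sc_eq_add_one x).symm⟩⟩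

theorem IsClTerm.isTerm {t : M} (h : IsClTerm t) : IsTerm t :=
  IsClTerm.induction IsTerm inferInstance isTerm_zero isTerm_one (fun _ => isTerm_succ)
    (fun _ _ => isTerm_add) (fun _ _ => isTerm_mul) h

/-! #### Occurrences of variables in terms -/

theorem occursIn_iff {i y : M} : OccursIn i y ↔
    y = cVar i ∨
    (∃ t, OccursIn i t ∧ y = cSucc t) ∨
    (∃ t s, IsTerm t ∧ IsTerm s ∧ (OccursIn i t ∨ OccursIn i s) ∧
      (y = cAdd t s ∨ y = cMul t s)) :=
  generated_unfold

theorem occursIn_var {i j : M} : OccursIn i (cVar j) ↔ j = i := by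
  rw [occursIn_iff]; simp [cVar, cSucc, cAdd, cMul]

theorem not_occursIn_zero {i : M} : ¬ OccursIn i cZero := by
  rw [occursIn_iff]; simp [cZero, cVar, cSucc, cAdd, cMul]

theorem not_occursIn_one {i : M} : ¬ OccursIn i cOne := by
  rw [occursIn_iff]; simp [cOne, cVar, cSucc, cAdd, cMul]

theorem occursIn_succ {i t : M} : OccursIn i (cSucc t) ↔ OccursIn i t := by
  rw [occursIn_iff]; simp [cVar, cSucc, cAdd, cMul]

theorem OccursIn.of_add {i t s : M} (h : OccursIn i (cAdd t s)) : OccursIn i t ∨ OccursIn i s := by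
  rw [occursIn_iff] at h; simp [cVar, cSucc, cAdd, cMul] at h; grind

theorem OccursIn.of_mul {i t s : M} (h : OccursIn i (cMul t s)) : OccursIn i t ∨ OccursIn i s := by
  rw [occursIn_iff] at h; simp [cVar, cSucc, cAdd, cMul] at h; grind

theorem IsClTerm.not_occursIn {t : M} (h : IsClTerm t) (i : M) : ¬ OccursIn i t := by
  refine IsClTerm.induction (fun t => ¬ OccursIn i t) inferInstance not_occursIn_zero
    not_occursIn_one (fun t h => by rwa [occursIn_succ])
    (fun t s h h' hts => hts.of_add.elim h h') (fun t s h h' hts => hts.of_mul.elim h h') h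

/-! #### Substitution in terms -/

theorem substTerm_iff {i t u u' : M} : SubstTerm i t u u' ↔
    pair u u' = pair (cVar i) t ∨
    (∃ j, j ≠ i ∧ pair u u' = pair (cVar j) (cVar j)) ∨
    pair u u' = pair cZero cZero ∨ pair u u' = pair cOne cOne ∨
    (∃ w w', SubstTerm i t w w' ∧ pair u u' = pair (cSucc w) (cSucc w')) ∨
    (∃ r r' w w', SubstTerm i t r r' ∧ SubstTerm i t w w' ∧
      (pair u u' = pair (cAdd r w) (cAdd r' w') ∨ pair u u' = pair (cMul r w) (cMul r' w'))) :=
  generated_unfold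

theorem substTerm_var_self {i t u : M} : SubstTerm i t (cVar i) u ↔ u = t := by
  rw [substTerm_iff]; simp [cVar, cZero, cOne, cSucc, cAdd, cMul]

theorem substTerm_var_ne {i j t u : M} (h : j ≠ i) : SubstTerm i t (cVar j) u ↔ u = cVar j := by
  rw [substTerm_iff]; simp [cVar, cZero, cOne, cSucc, cAdd, cMul, h]

theorem substTerm_zero {i t u : M} : SubstTerm i t cZero u ↔ u = cZero := by
  rw [substTerm_iff]; simp [cVar, cZero, cOne, cSucc, cAdd, cMul]

theorem substTerm_one {i t u : M} : SubstTerm i t cOne u ↔ u = cOne := by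
  rw [substTerm_iff]; simp [cVar, cZero, cOne, cSucc, cAdd, cMul]

theorem substTerm_succ {i t r u : M} :
    SubstTerm i t (cSucc r) u ↔ ∃ r', SubstTerm i t r r' ∧ u = cSucc r' := by
  rw [substTerm_iff]; simp [cVar, cZero, cOne, cSucc, cAdd, cMul]

theorem substTerm_add {i t r w u : M} : SubstTerm i t (cAdd r w) u ↔
    ∃ r' w', SubstTerm i t r r' ∧ SubstTerm i t w w' ∧ u = cAdd r' w' := by
  rw [substTerm_iff]; simp [cVar, cZero, cOne, cSucc, cAdd, cMul]

theorem substTerm_mul {i t r w u : M} : SubstTerm i t (cMul r w) u ↔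
    ∃ r' w', SubstTerm i t r r' ∧ SubstTerm i t w w' ∧ u = cMul r' w' := by
  rw [substTerm_iff]; simp [cVar, cZero, cOne, cSucc, cAdd, cMul]

theorem IsClTerm.substTerm_iff {r : M} (h : IsClTerm r) (i t u : M) :
    SubstTerm i t r u ↔ u = r := by
  refine IsClTerm.induction (fun r => ∀ u, SubstTerm i t r u ↔ u = r) inferInstance
    (fun u => substTerm_zero) (fun u => substTerm_one) ?_ ?_ ?_ h u
  · intro r h u; simp [substTerm_succ, h]
  · intro r s h h' u; simp [substTerm_add, h, h']
  · intro r s h h' u; simp [substTerm_mul, h, h']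

/-! #### Formulae and their free variables -/

theorem isForm_iff {y : M} : IsForm y ↔
    (∃ t s, IsTerm t ∧ IsTerm s ∧ (y = cEq t s ∨ y = cLe t s)) ∨
    (∃ φ, IsForm φ ∧ y = cNeg φ) ∨
    (∃ φ, IsForm φ ∧ ∃ ψ, IsForm ψ ∧ (y = cAnd φ ψ ∨ y = cOr φ ψ)) ∨
    (∃ i, ∃ φ, IsForm φ ∧ (y = cEx i φ ∨ y = cAll i φ)) :=
  generated_unfold

theorem isForm_eq {t s : M} (h : IsTerm t) (h' : IsTerm s) : IsForm (cEq t s) :=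
  isForm_iff.2 (.inl ⟨t, s, h, h', .inl rfl⟩)
theorem isForm_le {t s : M} (h : IsTerm t) (h' : IsTerm s) : IsForm (cLe t s) :=
  isForm_iff.2 (.inl ⟨t, s, h, h', .inr rfl⟩)
theorem isForm_neg {φ : M} (h : IsForm φ) : IsForm (cNeg φ) :=
  isForm_iff.2 (.inr (.inl ⟨φ, h, rfl⟩))
theorem isForm_and {φ ψ : M} (h : IsForm φ) (h' : IsForm ψ) : IsForm (cAnd φ ψ) :=
  isForm_iff.2 (.inr (.inr (.inl ⟨φ, h, ψ, h', .inl rfl⟩)))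
theorem isForm_or {φ ψ : M} (h : IsForm φ) (h' : IsForm ψ) : IsForm (cOr φ ψ) :=
  isForm_iff.2 (.inr (.inr (.inl ⟨φ, h, ψ, h', .inr rfl⟩)))
theorem isForm_ex {φ : M} (i : M) (h : IsForm φ) : IsForm (cEx i φ) :=
  isForm_iff.2 (.inr (.inr (.inr ⟨i, φ, h, .inl rfl⟩)))
theorem isForm_all {φ : M} (i : M) (h : IsForm φ) : IsForm (cAll i φ) :=
  isForm_iff.2 (.inr (.inr (.inr ⟨i, φ, h, .inr rfl⟩)))

theorem freeIn_iff {i y : M} : FreeIn i y ↔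
    (∃ t s, IsTerm t ∧ IsTerm s ∧ (OccursIn i t ∨ OccursIn i s) ∧ (y = cEq t s ∨ y = cLe t s)) ∨
    (∃ φ, FreeIn i φ ∧ y = cNeg φ) ∨
    (∃ φ ψ, IsForm φ ∧ IsForm ψ ∧ (FreeIn i φ ∨ FreeIn i ψ) ∧ (y = cAnd φ ψ ∨ y = cOr φ ψ)) ∨
    (∃ j, ∃ φ, FreeIn i φ ∧ j ≠ i ∧ (y = cEx j φ ∨ y = cAll j φ)) :=
  generated_unfold

theorem FreeIn.of_eq {i t s : M} (h : FreeIn i (cEq t s)) : OccursIn i t ∨ OccursIn i s := by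
  rw [freeIn_iff] at h; simp [cEq, cLe, cNeg, cAnd, cOr, cEx, cAll] at h; grind

theorem FreeIn.of_neg {i φ : M} (h : FreeIn i (cNeg φ)) : FreeIn i φ := by
  rw [freeIn_iff] at h; simpa [cEq, cLe, cNeg, cAnd, cOr, cEx, cAll] using h

theorem FreeIn.of_and {i φ ψ : M} (h : FreeIn i (cAnd φ ψ)) : FreeIn i φ ∨ FreeIn i ψ := by
  rw [freeIn_iff] at h; simp [cEq, cLe, cNeg, cAnd, cOr, cEx, cAll] at h; grind

theorem FreeIn.of_ex {i j φ : M} (h : FreeIn i (cEx j φ)) : FreeIn i φ ∧ j ≠ i := by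
  rw [freeIn_iff] at h; simpa [cEq, cLe, cNeg, cAnd, cOr, cEx, cAll] using h

/-! #### Substitution in formulae -/

theorem substForm_iff {i t φ φ' : M} : SubstForm i t φ φ' ↔
    (∃ u u' w w', SubstTerm i t u u' ∧ SubstTerm i t w w' ∧
      (pair φ φ' = pair (cEq u w) (cEq u' w') ∨ pair φ φ' = pair (cLe u w) (cLe u' w'))) ∨
    (∃ ψ ψ', SubstForm i t ψ ψ' ∧ pair φ φ' = pair (cNeg ψ) (cNeg ψ')) ∨
    (∃ ψ ψ' χ χ', SubstForm i t ψ ψ' ∧ SubstForm i t χ χ' ∧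
      (pair φ φ' = pair (cAnd ψ χ) (cAnd ψ' χ') ∨ pair φ φ' = pair (cOr ψ χ) (cOr ψ' χ'))) ∨
    (∃ j ψ ψ', j ≠ i ∧ SubstForm i t ψ ψ' ∧
      (pair φ φ' = pair (cEx j ψ) (cEx j ψ') ∨ pair φ φ' = pair (cAll j ψ) (cAll j ψ'))) ∨
    (∃ ψ, IsForm ψ ∧
      (pair φ φ' = pair (cEx i ψ) (cEx i ψ) ∨ pair φ φ' = pair (cAll i ψ) (cAll i ψ))) :=
  generated_unfold

variable {i t u φ ψ : M}

theorem substForm_eq {r s : M} : SubstForm i t (cEq r s) u ↔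
    ∃ r' s', SubstTerm i t r r' ∧ SubstTerm i t s s' ∧ u = cEq r' s' := by
  rw [substForm_iff]; simp [cEq, cLe, cNeg, cAnd, cOr, cEx, cAll]

theorem substForm_le {r s : M} : SubstForm i t (cLe r s) u ↔
    ∃ r' s', SubstTerm i t r r' ∧ SubstTerm i t s s' ∧ u = cLe r' s' := by
  rw [substForm_iff]; simp [cEq, cLe, cNeg, cAnd, cOr, cEx, cAll]

theorem substForm_neg : SubstForm i t (cNeg φ) u ↔ ∃ φ', SubstForm i t φ φ' ∧ u = cNeg φ' := by
  rw [substForm_iff]; simp [cEq, cLe, cNeg, cAnd, cOr, cEx, cAll]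

theorem substForm_and : SubstForm i t (cAnd φ ψ) u ↔
    ∃ φ' ψ', SubstForm i t φ φ' ∧ SubstForm i t ψ ψ' ∧ u = cAnd φ' ψ' := by
  rw [substForm_iff]; simp [cEq, cLe, cNeg, cAnd, cOr, cEx, cAll]

theorem substForm_or : SubstForm i t (cOr φ ψ) u ↔
    ∃ φ' ψ', SubstForm i t φ φ' ∧ SubstForm i t ψ ψ' ∧ u = cOr φ' ψ' := by
  rw [substForm_iff]; simp [cEq, cLe, cNeg, cAnd, cOr, cEx, cAll]

theorem substForm_ex_ne {j : M} (h : j ≠ i) :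
    SubstForm i t (cEx j φ) u ↔ ∃ φ', SubstForm i t φ φ' ∧ u = cEx j φ' := by
  rw [substForm_iff]; simp [cEq, cLe, cNeg, cAnd, cOr, cEx, cAll, h]

theorem substForm_all_ne {j : M} (h : j ≠ i) :
    SubstForm i t (cAll j φ) u ↔ ∃ φ', SubstForm i t φ φ' ∧ u = cAll j φ' := by
  rw [substForm_iff]; simp [cEq, cLe, cNeg, cAnd, cOr, cEx, cAll, h]

theorem substForm_ex_self : SubstForm i t (cEx i φ) u ↔ IsForm φ ∧ u = cEx i φ := by
  rw [substForm_iff]; simp [cEq, cLe, cNeg, cAnd, cOr, cEx, cAll]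

theorem substForm_all_self : SubstForm i t (cAll i φ) u ↔ IsForm φ ∧ u = cAll i φ := by
  rw [substForm_iff]; simp [cEq, cLe, cNeg, cAnd, cOr, cEx, cAll]

end InternalFormulae

/-! ### Codes of de Bruijn formulae and their truth -/

theorem forall_cons {M : Type*} {t : ℕ → M} {p : M → Prop} {x : M} (hx : p x)
    (h : ∀ j, p (t j)) (j : ℕ) : p (cons x t j) := by
  cases j with
  | zero => exact hx
  | succ j => exact h j

section Codes

variable {M : Type u} [LPA.Structure M]

/-- The code of a term, the variables being replaced by the terms with codes `t i`. -/
def Tm.code (t : ℕ → M) : Tm Empty → M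
  | .var i => t i
  | .const c => c.elim
  | .zero => cZero
  | .succ s => cSucc (s.code t)
  | .add s r => cAdd (s.code t) (r.code t)
  | .mul s r => cMul (s.code t) (r.code t)

/-- The code of a formula, the variables being replaced by the terms with codes `t i`, and the
predicates by the formulae with codes `θ i`, whose free variable is the `0`-th one. Bound variables
are named by numbers above `n`. -/
def PF.code {ι : Type*} (θ : ι → M) : ℕ → (ℕ → M) → PF ι Empty → M
  | _, t, .eq s r => cEq (s.code t) (r.code t)
  | n, t, .neg φ => cNeg (φ.code θ n t)
  | n, t, .and φ ψ => cAnd (φ.code θ n t) (ψ.code θ n t)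
  | n, t, .ex φ => cEx (std (n + 1)) (φ.code θ (n + 1) (cons (cVar (std (n + 1))) t))
  -- The existential form avoids substituting the term `s`, which may contain variables, into the
  -- possibly nonstandard `θ i`. Its truth condition is literally `Ev (θ i)` at the value of `s`, so
  -- `T` need not respect equality of values of closed terms.
  | _, t, .pred i s => cEx (std 0) (cAnd (cEq (cVar (std 0)) (s.code t)) (θ i))

/-- `θ` is a formula with at most the `0`-th variable free on which substitution behaves well. -/
def Good (θ : M) : Prop :=
  IsForm θ ∧ (∀ i, FreeIn i θ → i = std 0) ∧
    (∀ i r u, i ≠ std 0 → (SubstForm i r θ u ↔ u = θ)) ∧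
    ∀ r u, IsClTerm r → SubstForm (std 0) r θ u → IsSent u

/-- The formula `φ(v₀)`, with the predicates of `φ` replaced by the formulae `θ i`. -/
def wrap {ι : Type*} (φ : PF ι Empty) (θ : ι → M) : M :=
  cEx (std 1) (cAnd (cEq (cVar (std 1)) (cVar (std 0)))
    (φ.code θ 1 (cons (cVar (std 1)) fun _ => cZero)))

/-- The property expressed by the formula with code `θ`, according to `T`. -/
def Ev [LPred.Structure M] (θ x : M) : Prop :=
  ∃ r θ', IsClTerm r ∧ HasValue r x ∧ SubstForm (std 0) r θ θ' ∧ Tr θ'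

variable [hM : Fact (M ⊨ PA)] {t t' : ℕ → M} {i r u : M}

namespace Tm

theorem isTerm_code (h : ∀ j, IsTerm (t j)) (s : Tm Empty) : IsTerm (s.code t) := by
  induction s with
  | var i => exact h i
  | const c => exact c.elim
  | zero => exact isTerm_zero
  | succ s ih => exact isTerm_succ ih
  | add s r ih ih' => exact isTerm_add ih ih'
  | mul s r ih ih' => exact isTerm_mul ih ih'

theorem isClTerm_code (h : ∀ j, IsClTerm (t j)) (s : Tm Empty) : IsClTerm (s.code t) := by
  induction s with
  | var i => exact h i
  | const c => exact c.elim
  | zero => exact isClTerm_zero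
  | succ s ih => exact isClTerm_succ ih
  | add s r ih ih' => exact isClTerm_add ih ih'
  | mul s r ih ih' => exact isClTerm_mul ih ih'

theorem hasValue_code {x : ℕ → M} (h : ∀ j, HasValue (t j) (x j)) (s : Tm Empty) :
    HasValue (s.code t) (s.eval Empty.elim x) := by
  induction s with
  | var i => exact h i
  | const c => exact c.elim
  | zero => exact hasValue_zero.2 rfl
  | succ s ih => exact hasValue_succ.2 ⟨_, ih, rfl⟩
  | add s r ih ih' => exact hasValue_add.2 ⟨_, _, ih, ih', rfl⟩
  | mul s r ih ih' => exact hasValue_mul.2 ⟨_, _, ih, ih', rfl⟩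

theorem occursIn_code {s : Tm Empty} (h : OccursIn i (s.code t)) : ∃ j, OccursIn i (t j) := by
  induction s with
  | var j => exact ⟨j, h⟩
  | const c => exact c.elim
  | zero => exact absurd h not_occursIn_zero
  | succ s ih => exact ih (occursIn_succ.1 h)
  | add s r ih ih' => exact h.of_add.elim ih ih'
  | mul s r ih ih' => exact h.of_mul.elim ih ih'

theorem substTerm_code (h : ∀ j u, SubstTerm i r (t j) u ↔ u = t' j) (s : Tm Empty) (u : M) :
    SubstTerm i r (s.code t) u ↔ u = s.code t' := by
  induction s generalizing u with
  | var j => exact h j u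
  | const c => exact c.elim
  | zero => exact substTerm_zero
  | succ s ih => simp [Tm.code, substTerm_succ, ih]
  | add s r ih ih' => simp [Tm.code, substTerm_add, ih, ih']
  | mul s r ih ih' => simp [Tm.code, substTerm_mul, ih, ih']

end Tm

variable {ι : Type*} {θ : ι → M}

namespace PF

theorem isForm_code (hθ : ∀ k, Good (θ k)) (φ : PF ι Empty) (n : ℕ) (ht : ∀ j, IsTerm (t j)) :
    IsForm (φ.code θ n t) := by
  induction φ generalizing n t with
  | eq s r => exact isForm_eq (Tm.isTerm_code ht s) (Tm.isTerm_code ht r)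
  | neg φ ih => exact isForm_neg (ih n ht)
  | and φ ψ ih ih' => exact isForm_and (ih n ht) (ih' n ht)
  | ex φ ih => exact isForm_ex _ (ih (n + 1) (forall_cons (isTerm_var _) ht))
  | pred k s =>
    exact isForm_ex _ (isForm_and (isForm_eq (isTerm_var _) (Tm.isTerm_code ht s)) (hθ k).1)

theorem freeIn_code (hθ : ∀ k, Good (θ k)) {φ : PF ι Empty} {n : ℕ}
    (h : FreeIn i (φ.code θ n t)) : ∃ j, OccursIn i (t j) := by
  induction φ generalizing n t with
  | eq s r => exact h.of_eq.elim Tm.occursIn_code Tm.occursIn_code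
  | neg φ ih => exact ih h.of_neg
  | and φ ψ ih ih' => exact h.of_and.elim ih ih'
  | ex φ ih =>
    obtain ⟨h, hne⟩ := h.of_ex
    obtain ⟨j, hj⟩ := ih h
    cases j with
    | zero => exact absurd (occursIn_var.1 hj) hne
    | succ j => exact ⟨j, hj⟩
  | pred k s =>
    obtain ⟨h, hne⟩ := h.of_ex
    rcases h.of_and with h | h
    · rcases h.of_eq with h | h
      · exact absurd (occursIn_var.1 h) hne
      · exact Tm.occursIn_code h
    · exact absurd ((hθ k).2.1 i h).symm hne

theorem isSent_code (hθ : ∀ k, Good (θ k)) (φ : PF ι Empty) (n : ℕ) (ht : ∀ j, IsClTerm (t j)) :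
    IsSent (φ.code θ n t) :=
  ⟨isForm_code hθ φ n fun j => (ht j).isTerm, fun i h =>
    (freeIn_code hθ h).elim fun j hj => (ht j).not_occursIn i hj⟩

/-- The names reserved for bound variables are `0` (from predicates) and the numbers above `n`. For
such an `i` a quantifier may stop the substitution, so `hi` demands that it has no effect on the
terms `t j`. -/
theorem substForm_code (hθ : ∀ k, Good (θ k)) (φ : PF ι Empty) (n : ℕ)
    (hi : (i = std 0 ∨ ∃ m, n < m ∧ i = std m) → t' = t) (ht : ∀ j, IsTerm (t j))
    (h : ∀ j u, SubstTerm i r (t j) u ↔ u = t' j) (u : M) :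
    SubstForm i r (φ.code θ n t) u ↔ u = φ.code θ n t' := by
  induction φ generalizing n t t' u with
  | eq s r => simp [PF.code, substForm_eq, Tm.substTerm_code h]
  | neg φ ih => simp [PF.code, substForm_neg, ih n hi ht h]
  | and φ ψ ih ih' => simp [PF.code, substForm_and, ih n hi ht h, ih' n hi ht h]
  | ex φ ih =>
    by_cases hne : std (n + 1) = i
    · rw [hi (.inr ⟨n + 1, n.lt_succ_self, hne.symm⟩)]
      have := isForm_code hθ φ (n + 1) (forall_cons (isTerm_var (std (n + 1))) ht)
      subst hne
      simp [PF.code, substForm_ex_self, this]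
    · have := ih (n + 1) (t := cons (cVar (std (n + 1))) t) (t' := cons (cVar (std (n + 1))) t')
        (fun h => by
          rw [hi (h.imp id fun ⟨m, hm, e⟩ => ⟨m, Nat.lt_of_succ_lt hm, e⟩)])
        (forall_cons (isTerm_var _) ht) (fun j u => by
          cases j with
          | zero => exact substTerm_var_ne hne
          | succ j => exact h j u)
      simp [PF.code, substForm_ex_ne hne, this]
  | pred k s =>
    by_cases hi0 : i = std 0
    · rw [hi (.inl hi0)]
      subst hi0
      have : IsForm (cAnd (cEq (cVar (std 0)) (s.code t)) (θ k)) :=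
        isForm_and (isForm_eq (isTerm_var _) (Tm.isTerm_code ht s)) (hθ k).1
      simp [PF.code, substForm_ex_self, this]
    · simp [PF.code, substForm_ex_ne (Ne.symm hi0), substForm_and, substForm_eq,
        substTerm_var_ne (Ne.symm hi0), Tm.substTerm_code h, (hθ k).2.2.1 i _ _ hi0]

end PF

/-- Through the equation with variable `1`, variable `0` occurs free in `wrap φ θ` only once,
outside the code of `φ`, where its name is also used for bound variables. Substitution therefore
touches only that equation. -/
theorem substForm_zero_wrap (hθ : ∀ k, Good (θ k)) (φ : PF ι Empty) :
    SubstForm (std 0) r (wrap φ θ) u ↔ u = cEx (std 1) (cAnd (cEq (cVar (std 1)) r)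
      (φ.code θ 1 (cons (cVar (std 1)) fun _ => cZero))) := by
  have h10 : (std 1 : M) ≠ std 0 := by simp
  have := PF.substForm_code hθ φ 1 (i := std 0) (r := r) (t := cons (cVar (std 1)) fun _ => cZero)
    (fun _ => rfl) (forall_cons (isTerm_var _) fun _ => isTerm_zero) (fun j u => by
      cases j with
      | zero => exact substTerm_var_ne h10
      | succ j => exact substTerm_zero)
  simp [wrap, substForm_ex_ne h10, substForm_and, substForm_eq, substTerm_var_ne h10,
    substTerm_var_self, this]

theorem isSent_wrap_instance (hθ : ∀ k, Good (θ k)) (φ : PF ι Empty) (hr : IsClTerm r) :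
    IsSent (cEx (std 1) (cAnd (cEq (cVar (std 1)) r)
      (φ.code θ 1 (cons (cVar (std 1)) fun _ => cZero)))) := by
  refine ⟨isForm_ex _ (isForm_and (isForm_eq (isTerm_var _) hr.isTerm)
    (PF.isForm_code hθ φ 1 (forall_cons (isTerm_var _) fun _ => isTerm_zero))), fun i h => ?_⟩
  obtain ⟨h, hne⟩ := h.of_ex
  rcases h.of_and with h | h
  · rcases h.of_eq with h | h
    · exact hne (occursIn_var.1 h)
    · exact hr.not_occursIn i h
  · obtain ⟨j, hj⟩ := PF.freeIn_code hθ h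
    cases j with
    | zero => exact hne (occursIn_var.1 hj)
    | succ j => exact not_occursIn_zero hj

theorem good_wrap (hθ : ∀ k, Good (θ k)) (φ : PF ι Empty) : Good (wrap φ θ) := by
  have ht : ∀ j, IsTerm (cons (cVar (std 1)) (fun _ => cZero) j : M) :=
    forall_cons (isTerm_var _) fun _ => isTerm_zero
  have hbody : IsForm (cAnd (cEq (cVar (std 1)) (cVar (std 0)))
      (φ.code θ 1 (cons (cVar (std 1)) fun _ => cZero))) :=
    isForm_and (isForm_eq (isTerm_var _) (isTerm_var _)) (PF.isForm_code hθ φ 1 ht)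
  refine ⟨isForm_ex _ hbody, fun i h => ?_, fun i r u hi => ?_, fun r u hr h => ?_⟩
  · obtain ⟨h, hne⟩ := h.of_ex
    rcases h.of_and with h | h
    · rcases h.of_eq with h | h
      · exact absurd (occursIn_var.1 h) hne
      · exact (occursIn_var.1 h).symm
    · obtain ⟨j, hj⟩ := PF.freeIn_code hθ h
      cases j with
      | zero => exact absurd (occursIn_var.1 hj) hne
      | succ j => exact absurd hj not_occursIn_zero
  · by_cases h1 : std 1 = i
    · subst h1
      simp [wrap, substForm_ex_self, hbody]
    · have := PF.substForm_code hθ φ 1 (i := i) (r := r) (fun _ => rfl) ht (fun j u => by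
        cases j with
        | zero => exact substTerm_var_ne h1
        | succ j => exact substTerm_zero)
      simp [wrap, substForm_ex_ne h1, substForm_and, substForm_eq, substTerm_var_ne h1,
        substTerm_var_ne (Ne.symm hi), this]
  · rw [(substForm_zero_wrap hθ φ).1 h]
    exact isSent_wrap_instance hθ φ hr

theorem isSent_eq {s r : M} (hs : IsClTerm s) (hr : IsClTerm r) : IsSent (cEq s r) :=
  ⟨isForm_eq hs.isTerm hr.isTerm, fun i h => h.of_eq.elim (hs.not_occursIn i) (hr.not_occursIn i)⟩

/-! #### Truth -/

section Truth

variable [LPred.Structure M] (hCT : ModelsCTMinus M)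
include hCT

/-- External induction on the standard skeleton `φ`: the axioms of `CT⁻` unfold it, and the
plugged-in codes `θ k` enter only through `Ev`. -/
theorem tr_code_iff (hθ : ∀ k, Good (θ k)) (φ : PF ι Empty) (n : ℕ) {x : ℕ → M}
    (ht : ∀ j, IsClTerm (t j)) (hx : ∀ j, HasValue (t j) (x j)) :
    Tr (φ.code θ n t) ↔ φ.Sat Empty.elim (fun k => Ev (θ k)) x := by
  have hsent := PF.isSent_code hθ φ n ht
  induction φ generalizing n t x with
  | eq s r =>
    exact hCT.eq_iff _ _ _ _ (Tm.isClTerm_code ht s) (Tm.isClTerm_code ht r)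
      (Tm.hasValue_code hx s) (Tm.hasValue_code hx r)
  | neg φ ih =>
    have := PF.isSent_code hθ φ n ht
    exact (hCT.neg_iff _ this).trans (not_congr (ih n ht hx this))
  | and φ ψ ih ih' =>
    have := PF.isSent_code hθ φ n ht
    have h' := PF.isSent_code hθ ψ n ht
    exact (hCT.and_iff _ _ this h').trans (and_congr (ih n ht hx this) (ih' n ht hx h'))
  | ex φ ih =>
    -- Variable `n + 1` is not reserved at level `n + 1`, and the terms `t j` are closed, so
    -- substituting `s` changes just the new entry.
    have key : ∀ s u, SubstForm (std (n + 1)) s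
        (φ.code θ (n + 1) (cons (cVar (std (n + 1))) t)) u ↔ u = φ.code θ (n + 1) (cons s t) := by
      intro s u
      refine PF.substForm_code hθ φ (n + 1) (fun h => ?_)
        (forall_cons (isTerm_var _) fun j => (ht j).isTerm) (fun j u => ?_) u
      · rcases h with h | ⟨m, hm, h⟩
        · simp at h
        · simp at h; omega
      · cases j with
        | zero => exact substTerm_var_self
        | succ j => exact (ht j).substTerm_iff _ _ _
    refine (hCT.ex_iff _ _ hsent).trans ?_
    simp only [key]
    have step : ∀ s, IsClTerm s → ∀ y, HasValue s y →
        (Tr (φ.code θ (n + 1) (cons s t)) ↔ φ.Sat Empty.elim (fun k => Ev (θ k)) (cons y x)) := by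
      intro s hs y hy
      have hcl := forall_cons hs ht
      refine ih (n + 1) hcl (fun j => ?_) (PF.isSent_code hθ φ (n + 1) hcl)
      cases j with
      | zero => exact hy
      | succ j => exact hx j
    constructor
    · rintro ⟨s, u, hs, rfl, h⟩
      obtain ⟨y, hy⟩ := hs.exists_value
      exact ⟨y, (step s hs y hy).1 h⟩
    · rintro ⟨y, h⟩
      obtain ⟨s, hs, hy⟩ := exists_clTerm y
      exact ⟨s, _, hs, rfl, (step s hs y hy).2 h⟩
  | pred k s =>
    refine (hCT.ex_iff _ _ hsent).trans ?_
    have hcl := Tm.isClTerm_code ht s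
    simp only [substForm_and, substForm_eq, substTerm_var_self, hcl.substTerm_iff]
    have step : ∀ r θ', IsClTerm r → SubstForm (std 0) r (θ k) θ' → ∀ y, HasValue r y →
        (Tr (cAnd (cEq r (s.code t)) θ') ↔ y = s.eval Empty.elim x ∧ Tr θ') := by
      intro r θ' hr h y hy
      rw [hCT.and_iff _ _ (isSent_eq hr hcl) ((hθ k).2.2.2 r θ' hr h),
        hCT.eq_iff _ _ _ _ hr hcl hy (Tm.hasValue_code hx s)]
    constructor
    · rintro ⟨r, _, hr, ⟨_, θ', ⟨_, _, rfl, rfl, rfl⟩, h, rfl⟩, hT⟩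
      obtain ⟨y, hy⟩ := hr.exists_value
      obtain ⟨rfl, hT⟩ := (step _ θ' hr h y hy).1 hT
      exact ⟨_, θ', hr, hy, h, hT⟩
    · rintro ⟨r, θ', hr, hy, h, hT⟩
      exact ⟨r, _, hr, ⟨_, θ', ⟨_, _, rfl, rfl, rfl⟩, h, rfl⟩,
        (step r θ' hr h _ hy).2 ⟨rfl, hT⟩⟩

/-- The equation in `wrap` transfers the value of the substituted term to variable `1`, so the truth
of an instance depends only on that value. -/
theorem ev_wrap_iff (hθ : ∀ k, Good (θ k)) (φ : PF ι Empty) (x : M) :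
    Ev (wrap φ θ) x ↔ φ.Sat Empty.elim (fun k => Ev (θ k)) (cons x fun _ => 0) := by
  have key : ∀ s u, SubstForm (std 1) s
      (φ.code θ 1 (cons (cVar (std 1)) fun _ => cZero)) u ↔
        u = φ.code θ 1 (cons s fun _ => cZero) := by
    intro s u
    refine PF.substForm_code hθ φ 1 (fun h => ?_)
      (forall_cons (isTerm_var _) fun j => isTerm_zero) (fun j u => ?_) u
    · rcases h with h | ⟨m, hm, h⟩
      · simp at h
      · simp at h; omega
    · cases j with
      | zero => exact substTerm_var_self
      | succ j => exact substTerm_zero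
  have step : ∀ r s : M, IsClTerm r → IsClTerm s → ∀ x y, HasValue r x → HasValue s y →
      (Tr (cAnd (cEq s r) (φ.code θ 1 (cons s fun _ => cZero))) ↔
        y = x ∧ φ.Sat Empty.elim (fun k => Ev (θ k)) (cons y fun _ => 0)) := by
    intro r s hr hs x y hx hy
    have hcl := forall_cons (t := fun _ => (cZero : M)) hs fun _ => isClTerm_zero
    rw [hCT.and_iff _ _ (isSent_eq hs hr) (PF.isSent_code hθ φ 1 hcl),
      hCT.eq_iff _ _ _ _ hs hr hy hx,
      tr_code_iff hCT hθ φ 1 (x := cons y fun _ => 0) hcl fun j => by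
        cases j with
        | zero => exact hy
        | succ j => exact hasValue_zero.2 rfl]
  have tr : ∀ r : M, IsClTerm r → HasValue r x →
      (Tr (cEx (std 1) (cAnd (cEq (cVar (std 1)) r)
        (φ.code θ 1 (cons (cVar (std 1)) fun _ => cZero)))) ↔
        φ.Sat Empty.elim (fun k => Ev (θ k)) (cons x fun _ => 0)) := by
    intro r hr hx
    refine (hCT.ex_iff _ _ (isSent_wrap_instance hθ φ hr)).trans ?_
    simp only [substForm_and, substForm_eq, substTerm_var_self, hr.substTerm_iff, key]
    constructor
    · rintro ⟨s, _, hs, ⟨_, _, ⟨_, _, rfl, rfl, rfl⟩, rfl, rfl⟩, hT⟩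
      obtain ⟨y, hy⟩ := hs.exists_value
      obtain ⟨rfl, h⟩ := (step _ _ hr hs x y hx hy).1 hT
      exact h
    · intro h
      exact ⟨r, _, hr, ⟨_, _, ⟨_, _, rfl, rfl, rfl⟩, rfl, rfl⟩,
        (step r r hr hr x x hx hx).2 ⟨rfl, h⟩⟩
  simp only [Ev, substForm_zero_wrap hθ φ]
  constructor
  · rintro ⟨r, _, hr, hx, rfl, hT⟩
    exact (tr r hr hx).1 hT
  · intro h
    obtain ⟨r, hr, hx⟩ := exists_clTerm x
    exact ⟨r, _, hr, hx, rfl, (tr r hr hx).2 h⟩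

end Truth

end Codes

/-! ### Partial truth predicates -/

section PartialTruth

variable {M : Type u} [LPA.Structure M]

/-- The compositional clauses: `x` is true provided that `P` is truth for the immediate
subsentences of `x`. -/
def Compose (P : M → Prop) (x : M) : Prop :=
  (∃ t s a : M, HasValue t a ∧ HasValue s a ∧ x = cEq t s) ∨
  (∃ t s a b : M, HasValue t a ∧ HasValue s b ∧ leInst.le a b ∧ x = cLe t s) ∨
  (∃ y, x = cNeg y ∧ ¬ P y) ∨
  (∃ y z, x = cAnd y z ∧ P y ∧ P z) ∨
  (∃ y z, x = cOr y z ∧ (P y ∨ P z)) ∨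
  (∃ i y, x = cEx i y ∧ ∃ t z, IsClTerm t ∧ SubstForm i t y z ∧ P z) ∨
  (∃ i y, x = cAll i y ∧ ∀ t z, IsClTerm t → SubstForm i t y z → P z)

/-- Truth for formulae of depth at most `n`. -/
def partialTruth : ℕ → M → Prop
  | 0 => fun _ => False
  | n + 1 => Compose (partialTruth n)

/-- The formula `φ` has depth at most `n`, atomic formulae having depth `1`. -/
def Depth (φ n : M) : Prop :=
  Generated (fun X p =>
    (∃ t s n, p = pair (cEq t s) (sc n) ∨ p = pair (cLe t s) (sc n)) ∨
    (∃ φ n, pair φ n ∈ X ∧ (p = pair φ (sc n) ∨ p = pair (cNeg φ) (sc n))) ∨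
    (∃ φ ψ n, pair φ n ∈ X ∧ pair ψ n ∈ X ∧
      (p = pair (cAnd φ ψ) (sc n) ∨ p = pair (cOr φ ψ) (sc n))) ∨
    (∃ i φ n, pair φ n ∈ X ∧ (p = pair (cEx i φ) (sc n) ∨ p = pair (cAll i φ) (sc n))))
    (pair φ n)

variable [hM : Fact (M ⊨ PA)]

theorem depth_iff {x n : M} : Depth x n ↔
    (∃ t s m, pair x n = pair (cEq t s) (sc m) ∨ pair x n = pair (cLe t s) (sc m)) ∨
    (∃ φ m, Depth φ m ∧ (pair x n = pair φ (sc m) ∨ pair x n = pair (cNeg φ) (sc m))) ∨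
    (∃ φ ψ m, Depth φ m ∧ Depth ψ m ∧
      (pair x n = pair (cAnd φ ψ) (sc m) ∨ pair x n = pair (cOr φ ψ) (sc m))) ∨
    (∃ i φ m, Depth φ m ∧ (pair x n = pair (cEx i φ) (sc m) ∨ pair x n = pair (cAll i φ) (sc m))) :=
  generated_unfold

theorem sc_inj_iff {x y : M} : sc x = sc y ↔ x = y := ⟨sc_inj hM.out, congrArg sc⟩

theorem not_depth_zero {x : M} : ¬ Depth x (std 0) := by
  have h : ∀ m : M, std 0 ≠ sc m := fun m h => sc_ne_zero hM.out m h.symm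
  rw [depth_iff]; simp [h]

theorem depth_succ {x : M} {n : ℕ} : Depth x (std (n + 1)) ↔
    (∃ t s, x = cEq t s ∨ x = cLe t s) ∨ Depth x (std n) ∨
    (∃ φ, Depth φ (std n) ∧ x = cNeg φ) ∨
    (∃ φ ψ, Depth φ (std n) ∧ Depth ψ (std n) ∧ (x = cAnd φ ψ ∨ x = cOr φ ψ)) ∨
    (∃ i φ, Depth φ (std n) ∧ (x = cEx i φ ∨ x = cAll i φ)) := by
  rw [depth_iff]; simp [std]; simp [sc_inj_iff]; grind

theorem depth_eq (t s : M) (n : ℕ) : Depth (cEq t s) (std (n + 1)) :=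
  depth_succ.2 (.inl ⟨t, s, .inl rfl⟩)
theorem depth_le (t s : M) (n : ℕ) : Depth (cLe t s) (std (n + 1)) :=
  depth_succ.2 (.inl ⟨t, s, .inr rfl⟩)

section Depth

variable {φ ψ : M} {n : ℕ}

theorem Depth.weaken (h : Depth φ (std n)) : Depth φ (std (n + 1)) :=
  depth_succ.2 (.inr (.inl h))
theorem Depth.neg (h : Depth φ (std n)) : Depth (cNeg φ) (std (n + 1)) :=
  depth_succ.2 (.inr (.inr (.inl ⟨φ, h, rfl⟩)))
theorem Depth.and (h : Depth φ (std n)) (h' : Depth ψ (std n)) :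
    Depth (cAnd φ ψ) (std (n + 1)) :=
  depth_succ.2 (.inr (.inr (.inr (.inl ⟨φ, ψ, h, h', .inl rfl⟩))))
theorem Depth.or (h : Depth φ (std n)) (h' : Depth ψ (std n)) :
    Depth (cOr φ ψ) (std (n + 1)) :=
  depth_succ.2 (.inr (.inr (.inr (.inl ⟨φ, ψ, h, h', .inr rfl⟩))))
theorem Depth.ex (i : M) (h : Depth φ (std n)) : Depth (cEx i φ) (std (n + 1)) :=
  depth_succ.2 (.inr (.inr (.inr (.inr ⟨i, φ, h, .inl rfl⟩))))
theorem Depth.all (i : M) (h : Depth φ (std n)) : Depth (cAll i φ) (std (n + 1)) :=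
  depth_succ.2 (.inr (.inr (.inr (.inr ⟨i, φ, h, .inr rfl⟩))))

end Depth

theorem Depth.mono {x : M} {m n : ℕ} (hmn : m ≤ n) (h : Depth x (std m)) : Depth x (std n) := by
  induction hmn with
  | refl => exact h
  | step _ ih => exact ih.weaken

/-- Only terms change, and all atomic formulae have the same depth. Hence the quantifier clauses of
`Compose` consult only instances of smaller depth. -/
theorem Depth.subst {n : ℕ} {i t x y : M} (hx : Depth x (std n)) (hs : SubstForm i t x y) :
    Depth y (std n) := by
  induction n generalizing x y with
  | zero => exact absurd hx not_depth_zero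
  | succ n ih =>
    rcases depth_succ.1 hx with ⟨s, r, rfl | rfl⟩ | h | ⟨φ, h, rfl⟩ | ⟨φ, ψ, h, h', rfl | rfl⟩ |
      ⟨j, φ, h, rfl | rfl⟩
    · obtain ⟨s', r', -, -, rfl⟩ := substForm_eq.1 hs
      exact depth_eq _ _ _
    · obtain ⟨s', r', -, -, rfl⟩ := substForm_le.1 hs
      exact depth_le _ _ _
    · exact (ih h hs).weaken
    · obtain ⟨φ', h', rfl⟩ := substForm_neg.1 hs
      exact (ih h h').neg
    · obtain ⟨φ', ψ', h₁, h₂, rfl⟩ := substForm_and.1 hs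
      exact (ih h h₁).and (ih h' h₂)
    · obtain ⟨φ', ψ', h₁, h₂, rfl⟩ := substForm_or.1 hs
      exact (ih h h₁).or (ih h' h₂)
    · by_cases hj : j = i
      · subst hj
        obtain ⟨-, rfl⟩ := substForm_ex_self.1 hs
        exact h.ex _
      · obtain ⟨φ', h', rfl⟩ := (substForm_ex_ne hj).1 hs
        exact (ih h h').ex _
    · by_cases hj : j = i
      · subst hj
        obtain ⟨-, rfl⟩ := substForm_all_self.1 hs
        exact h.all _
      · obtain ⟨φ', h', rfl⟩ := (substForm_all_ne hj).1 hs
        exact (ih h h').all _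

section Clauses

variable {P : M → Prop} {t s y z i : M}

theorem compose_eq : Compose P (cEq t s) ↔ ∃ a, HasValue t a ∧ HasValue s a := by
  simp [Compose, cEq, cLe, cNeg, cAnd, cOr, cEx, cAll]

theorem compose_le : Compose P (cLe t s) ↔ ∃ a b, HasValue t a ∧ HasValue s b ∧ a ≤ b := by
  simp [Compose, cEq, cLe, cNeg, cAnd, cOr, cEx, cAll]

theorem compose_neg : Compose P (cNeg y) ↔ ¬ P y := by
  simp [Compose, cEq, cLe, cNeg, cAnd, cOr, cEx, cAll]

theorem compose_and : Compose P (cAnd y z) ↔ P y ∧ P z := by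
  simp [Compose, cEq, cLe, cNeg, cAnd, cOr, cEx, cAll]

theorem compose_or : Compose P (cOr y z) ↔ P y ∨ P z := by
  simp [Compose, cEq, cLe, cNeg, cAnd, cOr, cEx, cAll]

theorem compose_ex :
    Compose P (cEx i y) ↔ ∃ t z, IsClTerm t ∧ SubstForm i t y z ∧ P z := by
  simp [Compose, cEq, cLe, cNeg, cAnd, cOr, cEx, cAll]

theorem compose_all :
    Compose P (cAll i y) ↔ ∀ t z, IsClTerm t → SubstForm i t y z → P z := by
  simp [Compose, cEq, cLe, cNeg, cAnd, cOr, cEx, cAll]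

end Clauses

/-- Each clause asks about immediate subformulae or their instances, which have depth at most `n`.
The induction on `n` serves only the case in which depth `n + 1` comes by weakening from depth `n`.
-/
theorem Compose.congr {n : ℕ} {P Q : M → Prop} (h : ∀ y, Depth y (std n) → (P y ↔ Q y)) {x : M}
    (hx : Depth x (std (n + 1))) : Compose P x ↔ Compose Q x := by
  induction n generalizing x with
  | zero =>
    rcases depth_succ.1 hx with ⟨s, r, rfl | rfl⟩ | h | ⟨φ, h, -⟩ | ⟨φ, ψ, h, -⟩ | ⟨j, φ, h, -⟩
    · simp only [compose_eq]
    · simp only [compose_le]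
    all_goals exact absurd h not_depth_zero
  | succ n ih =>
    rcases depth_succ.1 hx with ⟨s, r, rfl | rfl⟩ | hx | ⟨φ, hφ, rfl⟩ | ⟨φ, ψ, hφ, hψ, rfl | rfl⟩ |
      ⟨j, φ, hφ, rfl | rfl⟩
    · simp only [compose_eq]
    · simp only [compose_le]
    · exact ih (fun y hy => h y (hy.mono n.le_succ)) hx
    · simp only [compose_neg, h φ hφ]
    · simp only [compose_and, h φ hφ, h ψ hψ]
    · simp only [compose_or, h φ hφ, h ψ hψ]
    · simp only [compose_ex]
      exact exists_congr fun t => exists_congr fun z => and_congr_right fun _ =>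
        and_congr_right fun hz => h z (hφ.subst hz)
    · simp only [compose_all]
      exact forall_congr' fun t => forall_congr' fun z => forall_congr' fun _ =>
        forall_congr' fun hz => h z (hφ.subst hz)

theorem partialTruth_stable {i r r' : ℕ} {x : M} (hx : Depth x (std i)) (hr : i ≤ r)
    (hr' : i ≤ r') : partialTruth r x ↔ partialTruth r' x := by
  induction i generalizing r r' x with
  | zero => exact absurd hx not_depth_zero
  | succ i ih =>
    obtain ⟨r, rfl⟩ := Nat.exists_eq_succ_of_ne_zero (by omega : r ≠ 0)
    obtain ⟨r', rfl⟩ := Nat.exists_eq_succ_of_ne_zero (by omega : r' ≠ 0)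
    exact Compose.congr (fun y hy => ih hy (by omega) (by omega)) hx

/-- The right side is `partialTruth (r + 1)`, which agrees with level `r` on depth at most `r`. That
depth `r` itself is included is what later raises the rank. -/
theorem partialTruth_fixed {i r : ℕ} {x : M} (hx : Depth x (std i)) (hr : i ≤ r) :
    partialTruth r x ↔ Compose (partialTruth r) x :=
  partialTruth_stable hx hr (hr.trans r.le_succ)

/-! #### Disquotation for standard formulae -/

variable {t t' : ℕ → M} {i r : M}

namespace ATerm

theorem isTerm_code (h : ∀ j, IsTerm (t j)) (s : ATerm) : IsTerm (s.code t) := by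
  induction s with
  | var i => exact h i
  | zero => exact isTerm_zero
  | one => exact isTerm_one
  | succ s ih => exact isTerm_succ ih
  | add s r ih ih' => exact isTerm_add ih ih'
  | mul s r ih ih' => exact isTerm_mul ih ih'

theorem isClTerm_code (h : ∀ j, IsClTerm (t j)) (s : ATerm) : IsClTerm (s.code t) := by
  induction s with
  | var i => exact h i
  | zero => exact isClTerm_zero
  | one => exact isClTerm_one
  | succ s ih => exact isClTerm_succ ih
  | add s r ih ih' => exact isClTerm_add ih ih'
  | mul s r ih ih' => exact isClTerm_mul ih ih'

theorem hasValue_code {x : ℕ → M} (h : ∀ j, HasValue (t j) (x j)) (s : ATerm) :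
    HasValue (s.code t) (s.eval x) := by
  induction s with
  | var i => exact h i
  | zero => exact hasValue_zero.2 rfl
  | one => exact hasValue_one.2 rfl
  | succ s ih => exact hasValue_succ.2 ⟨_, ih, rfl⟩
  | add s r ih ih' => exact hasValue_add.2 ⟨_, _, ih, ih', rfl⟩
  | mul s r ih ih' => exact hasValue_mul.2 ⟨_, _, ih, ih', rfl⟩

theorem substTerm_code (h : ∀ j u, SubstTerm i r (t j) u ↔ u = t' j) (s : ATerm) (u : M) :
    SubstTerm i r (s.code t) u ↔ u = s.code t' := by
  induction s generalizing u with
  | var j => exact h j u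
  | zero => exact substTerm_zero
  | one => exact substTerm_one
  | succ s ih => simp [ATerm.code, substTerm_succ, ih]
  | add s r ih ih' => simp [ATerm.code, substTerm_add, ih, ih']
  | mul s r ih ih' => simp [ATerm.code, substTerm_mul, ih, ih']

end ATerm

theorem forall_update {M : Type*} {t : ℕ → M} {p : M → Prop} {x : M} (hx : p x)
    (h : ∀ j, p (t j)) (i j : ℕ) : p (Function.update t i x j) := by
  rcases eq_or_ne j i with rfl | hj
  · simpa using hx
  · simpa [hj] using h j

namespace AForm

theorem isForm_code (ht : ∀ j, IsTerm (t j)) (φ : AForm) : IsForm (φ.code t) := by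
  induction φ generalizing t with
  | eq s r => exact isForm_eq (ATerm.isTerm_code ht s) (ATerm.isTerm_code ht r)
  | le s r => exact isForm_le (ATerm.isTerm_code ht s) (ATerm.isTerm_code ht r)
  | neg φ ih => exact isForm_neg (ih ht)
  | and φ ψ ih ih' => exact isForm_and (ih ht) (ih' ht)
  | or φ ψ ih ih' => exact isForm_or (ih ht) (ih' ht)
  | ex i φ ih => exact isForm_ex _ (ih (forall_update (isTerm_var _) ht i))
  | all i φ ih => exact isForm_all _ (ih (forall_update (isTerm_var _) ht i))

theorem update_eq_of_std_eq (hi : ∀ j, std j ≠ i → t' j = t j) {j : ℕ} (hj : std j = i) (x : M) :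
    Function.update t' j x = Function.update t j x := by
  funext k
  rcases eq_or_ne k j with rfl | hk
  · simp
  · simp [hk, hi k (by rw [← hj]; simpa using hk)]

/-- By `hi` the assignments differ at most at variable `i`. Under a quantifier binding that variable
both are overwritten there and coincide, which matches the rule that the substitution stops. -/
theorem substForm_code (φ : AForm) (hi : ∀ j, std j ≠ i → t' j = t j) (ht : ∀ j, IsTerm (t j))
    (h : ∀ j u, SubstTerm i r (t j) u ↔ u = t' j) (u : M) :
    SubstForm i r (φ.code t) u ↔ u = φ.code t' := by
  have step : ∀ (φ : AForm) (j : ℕ), std j ≠ i →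
      (∀ {t t' : ℕ → M}, (∀ j, std j ≠ i → t' j = t j) → (∀ j, IsTerm (t j)) →
        (∀ j u, SubstTerm i r (t j) u ↔ u = t' j) →
        ∀ u, SubstForm i r (φ.code t) u ↔ u = φ.code t') → ∀ {t t' : ℕ → M},
      (∀ j, std j ≠ i → t' j = t j) → (∀ j, IsTerm (t j)) →
        (∀ j u, SubstTerm i r (t j) u ↔ u = t' j) → ∀ u,
      SubstForm i r (φ.code (Function.update t j (cVar (std j)))) u ↔
        u = φ.code (Function.update t' j (cVar (std j))) := by
    intro φ j hj ih t t' hi ht h u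
    refine ih (fun k hk => ?_) (forall_update (isTerm_var _) ht j) (fun k u => ?_) u
    · rcases eq_or_ne k j with rfl | hkj
      · simp
      · simp [hkj, hi k hk]
    · rcases eq_or_ne k j with rfl | hkj
      · simpa using substTerm_var_ne hj
      · simpa [hkj] using h k u
  induction φ generalizing t t' u with
  | eq s r => simp [AForm.code, substForm_eq, ATerm.substTerm_code h]
  | le s r => simp [AForm.code, substForm_le, ATerm.substTerm_code h]
  | neg φ ih => simp [AForm.code, substForm_neg, ih hi ht h]
  | and φ ψ ih ih' => simp [AForm.code, substForm_and, ih hi ht h, ih' hi ht h]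
  | or φ ψ ih ih' => simp [AForm.code, substForm_or, ih hi ht h, ih' hi ht h]
  | ex j φ ih =>
    by_cases hj : std j = i
    · have := isForm_code (forall_update (isTerm_var (std j)) ht j) φ
      simp only [AForm.code, update_eq_of_std_eq hi hj]
      subst hj
      simp [substForm_ex_self, this]
    · simp [AForm.code, substForm_ex_ne hj, step φ j hj ih hi ht h]
  | all j φ ih =>
    by_cases hj : std j = i
    · have := isForm_code (forall_update (isTerm_var (std j)) ht j) φ
      simp only [AForm.code, update_eq_of_std_eq hi hj]
      subst hj
      simp [substForm_all_self, this]
    · simp [AForm.code, substForm_all_ne hj, step φ j hj ih hi ht h]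

theorem substForm_code_update (φ : AForm) (ht : ∀ j, IsClTerm (t j)) (i : ℕ) (r u : M) :
    SubstForm (std i) r (φ.code (Function.update t i (cVar (std i)))) u ↔
      u = φ.code (Function.update t i r) := by
  refine substForm_code φ (fun j hj => ?_)
    (forall_update (isTerm_var _) (fun j => (ht j).isTerm) i) (fun j u => ?_) u
  · have : j ≠ i := fun h => hj (by rw [h])
    simp [this]
  · rcases eq_or_ne j i with rfl | hj
    · simpa using substTerm_var_self
    · simpa [hj] using (ht j).substTerm_iff _ _ _

theorem exists_depth (φ : AForm) (t : ℕ → M) : ∃ n : ℕ, Depth (φ.code t) (std n) := by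
  induction φ generalizing t with
  | eq s r => exact ⟨1, depth_eq _ _ 0⟩
  | le s r => exact ⟨1, depth_le _ _ 0⟩
  | neg φ ih =>
    obtain ⟨n, h⟩ := ih t
    exact ⟨n + 1, h.neg⟩
  | and φ ψ ih ih' =>
    obtain ⟨n, h⟩ := ih t
    obtain ⟨m, h'⟩ := ih' t
    exact ⟨max n m + 1, (h.mono (le_max_left _ _)).and (h'.mono (le_max_right _ _))⟩
  | or φ ψ ih ih' =>
    obtain ⟨n, h⟩ := ih t
    obtain ⟨m, h'⟩ := ih' t
    exact ⟨max n m + 1, (h.mono (le_max_left _ _)).or (h'.mono (le_max_right _ _))⟩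
  | ex i φ ih =>
    obtain ⟨n, h⟩ := ih (Function.update t i (cVar (std i)))
    exact ⟨n + 1, h.ex _⟩
  | all i φ ih =>
    obtain ⟨n, h⟩ := ih (Function.update t i (cVar (std i)))
    exact ⟨n + 1, h.all _⟩

/-- A property which is compositional for all formulae of standard depth is truth for standard
formulae. -/
theorem disquotation {B : M → Prop} (hB : ∀ (n : ℕ) (x : M), Depth x (std n) → (B x ↔ Compose B x))
    (φ : AForm) {t x : ℕ → M} (ht : ∀ i, IsClTerm (t i)) (hx : ∀ i, HasValue (t i) (x i)) :
    B (φ.code t) ↔ φ.Sat x := by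
  have hBφ : ∀ (φ : AForm) (t : ℕ → M), B (φ.code t) ↔ Compose B (φ.code t) := fun φ t =>
    (exists_depth φ t).elim fun n hn => hB n _ hn
  have hval : ∀ (s : ATerm) {t x : ℕ → M}, (∀ i, IsClTerm (t i)) → (∀ i, HasValue (t i) (x i)) →
      ∀ a, HasValue (s.code t) a ↔ a = s.eval x := fun s t x ht hx a =>
    ⟨fun h => (ATerm.isClTerm_code ht s).value_unique h (ATerm.hasValue_code hx s),
      fun h => h ▸ ATerm.hasValue_code hx s⟩
  have hupd : ∀ {t x : ℕ → M}, (∀ i, HasValue (t i) (x i)) → ∀ (i : ℕ) {s y : M}, HasValue s y →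
      ∀ j, HasValue (Function.update t i s j) (Function.update x i y j) := by
    intro t x hx i s y hy j
    rcases eq_or_ne j i with rfl | hj
    · simpa using hy
    · simpa [hj] using hx j
  induction φ generalizing t x with
  | eq s r =>
    rw [hBφ]
    simp only [AForm.code, compose_eq, hval _ ht hx, AForm.Sat]
    exact ⟨fun ⟨a, h, h'⟩ => h.symm.trans h', fun h => ⟨_, rfl, h⟩⟩
  | le s r =>
    rw [hBφ]
    simp only [AForm.code, compose_le, hval _ ht hx, AForm.Sat]
    exact ⟨fun ⟨a, b, h, h', hab⟩ => by rw [h, h'] at hab; exact hab,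
      fun h => ⟨_, _, rfl, rfl, h⟩⟩
  | neg φ ih =>
    rw [hBφ]
    simp only [AForm.code, compose_neg, AForm.Sat, ih ht hx]
  | and φ ψ ih ih' =>
    rw [hBφ]
    simp only [AForm.code, compose_and, AForm.Sat, ih ht hx, ih' ht hx]
  | or φ ψ ih ih' =>
    rw [hBφ]
    simp only [AForm.code, compose_or, AForm.Sat, ih ht hx, ih' ht hx]
  | ex i φ ih =>
    rw [hBφ]
    simp only [AForm.code, compose_ex, AForm.Sat, substForm_code_update φ ht]
    constructor
    · rintro ⟨s, _, hs, rfl, h⟩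
      obtain ⟨y, hy⟩ := hs.exists_value
      exact ⟨y, (ih (forall_update hs ht i) (hupd hx i hy)).1 h⟩
    · rintro ⟨y, h⟩
      obtain ⟨s, hs, hy⟩ := exists_clTerm y
      exact ⟨s, _, hs, rfl, (ih (forall_update hs ht i) (hupd hx i hy)).2 h⟩
  | all i φ ih =>
    rw [hBφ]
    simp only [AForm.code, compose_all, AForm.Sat, substForm_code_update φ ht]
    constructor
    · intro h y
      obtain ⟨s, hs, hy⟩ := exists_clTerm y
      exact (ih (forall_update hs ht i) (hupd hx i hy)).1 (h s _ hs rfl)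
    · rintro h s _ hs rfl
      obtain ⟨y, hy⟩ := hs.exists_value
      exact (ih (forall_update hs ht i) (hupd hx i hy)).2 (h y)

end AForm

end PartialTruth

/-! ### Definability of the auxiliary notions -/

section DefinabilityOfNotions

variable {M : Type u} [LPA.Structure M] {ι C : Type*} {κ : C → M}

/-- For a standard skeleton, plugging in codes is a polynomial operation of these codes. This makes
the constructions on `β` and `D` arithmetical, hence iterable inside `M`. -/
theorem TDef.code (φ : PF ι Empty) (θ : ι → (ℕ → M) → M) (hθ : ∀ k, TDef (id : M → M) (θ k))
    (n : ℕ) (t : ℕ → M) : TDef (id : M → M) fun v => φ.code (fun k => θ k v) n t := by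
  induction φ generalizing n t with
  | eq s r => exact TDef.const _
  | neg φ ih => have := ih n t; unfold PF.code; infer_instance
  | and φ ψ ih ih' => have := ih n t; have := ih' n t; unfold PF.code; infer_instance
  | ex φ ih =>
    have := ih (n + 1) (cons (CTPaper.cVar (CTPaper.std (n + 1))) t)
    unfold PF.code; infer_instance
  | pred k s => have := hθ k; unfold PF.code; infer_instance

instance TDef.wrap (φ : PF ι Empty) (θ : ι → (ℕ → M) → M) [hθ : ∀ k, TDef (id : M → M) (θ k)] :
    TDef (id : M → M) fun v => wrap φ fun k => θ k v := by
  have := TDef.code φ θ hθ 1 (cons (CTPaper.cVar (CTPaper.std 1)) fun _ => CTPaper.cZero)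
  unfold CTPaper.wrap; infer_instance

instance TDef.cond (b : Bool) (f g : (ℕ → M) → M) [TDef (id : M → M) f] [TDef (id : M → M) g] :
    TDef (id : M → M) fun v => bif b then f v else g v := by
  cases b <;> assumption

variable [hM : Fact (M ⊨ PA)]

set_option synthInstance.maxSize 4000
set_option synthInstance.maxHeartbeats 400000

instance Def.depth (f g : (ℕ → M) → M) [TDef κ f] [TDef κ g] :
    Def (ι := ι) κ fun _ v => Depth (f v) (g v) := by
  unfold Depth Generated; simp only [Set.mem_ofPred_eq]; infer_instance

instance Def.good (f : (ℕ → M) → M) [TDef κ f] : Def (ι := ι) κ fun _ v => Good (f v) := by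
  unfold Good; infer_instance

instance Def.composePred (i : ι) (f g : (ℕ → M) → M) [TDef κ f] [TDef κ g] :
    Def κ fun P v => Compose (fun z => P i (pair z (g v))) (f v) := by
  unfold Compose; infer_instance

instance Def.compose (i : ι) (f : (ℕ → M) → M) [TDef κ f] :
    Def κ fun P v => Compose (P i) (f v) := by
  unfold Compose; infer_instance

end DefinabilityOfNotions

/-! ### Substitution for the predicate `P` -/

section PredicateSubstitution

variable {M : Type u} [LPA.Structure M] {α : Type*}

/-- Satisfaction of a formula of `LPAP` in the expansion of `M` by `P`. -/
def PredSat (P : M → Prop) :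
    {n : ℕ} → LPAP.BoundedFormula α n → (α → M) → (Fin n → M) → Prop
  | _, .falsum, _, _ => False
  | _, .equal t s, v, xs =>
      (liftTerm (LHom.id LPA) t).realize (Sum.elim v xs) =
        (liftTerm (LHom.id LPA) s).realize (Sum.elim v xs)
  | _, .rel (Sum.inl R) ts, v, xs =>
      Structure.RelMap R fun i => (liftTerm (LHom.id LPA) (ts i)).realize (Sum.elim v xs)
  | _, .rel (Sum.inr UnaryRel.pred) ts, v, xs =>
      P ((liftTerm (LHom.id LPA) (ts 0)).realize (Sum.elim v xs))
  | _, .imp f g, v, xs => PredSat P f v xs → PredSat P g v xs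
  | _, .all f, v, xs => ∀ x, PredSat P f v (Fin.snoc xs x)

theorem realize_liftTerm {L' : Language} [L'.Structure M] (e : LPA →ᴸ L') [e.IsExpansionOn M]
    {β : Type*} (t : LPAP.Term β) (v : β → M) :
    (liftTerm e t).realize v = (liftTerm (LHom.id LPA) t).realize v := by
  induction t with
  | var x => rfl
  | func f ts ih =>
    rcases f with f | f
    · simp only [liftTerm]
      rw [realize_func_onFunction, realize_func_onFunction]
      simp only [ih]
    · exact f.elim

/-- `PredSat` depends only on the set that `φ` defines. It thus links the hypothesis, about
arithmetical formulae, with the conclusion, about formulae in `T` with parameters. -/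
theorem realize_substPred {L' : Language} [L'.Structure M] (e : LPA →ᴸ L') [e.IsExpansionOn M]
    (φ : L'.Formula (Fin 1)) {n : ℕ} (δ : LPAP.BoundedFormula α n) (v : α → M) (xs : Fin n → M) :
    (substPred e φ δ).Realize v xs ↔ PredSat (fun x => φ.Realize fun _ => x) δ v xs := by
  induction δ with
  | falsum => rfl
  | equal t s =>
    simp only [substPred, BoundedFormula.Realize, PredSat, realize_liftTerm e]
  | rel R ts =>
    rcases R with R | R
    · simp only [substPred, BoundedFormula.Realize, PredSat, realize_liftTerm e]
      exact iff_of_eq (LHom.map_onRelation (M := M) e R _)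
    · cases R
      simp only [substPred, PredSat]
      rw [BoundedFormula.realize_relabel, BoundedFormula.realize_subst]
      simp only [Function.comp_id, realize_liftTerm e]
      exact iff_of_eq (congrArg _ (Subsingleton.elim _ _))
  | imp f g ihf ihg =>
    simp only [substPred, BoundedFormula.realize_imp, PredSat, ihf, ihg]
  | all f ih =>
    simp only [substPred, BoundedFormula.realize_all, PredSat, ih]

/-! ### Definability of satisfaction for `δ`. -/

variable {ι C : Type*} {κ : C → M}

/-- A block of `k` quantifiers, peeled off from the outside: the last coordinate is bound outermost,
so the coordinates `j < k` become the de Bruijn indices `j`. -/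
theorem Def.forall_fin (k : ℕ) (R : (ι → M → Prop) → (Fin k → M) → (ℕ → M) → Prop)
    (h : Def κ fun P v => R P (fun j => v j) fun i => v (i + k)) :
    Def κ fun P v => ∀ w, R P w v := by
  induction k with
  | zero =>
    exact h.congr fun P v => ⟨fun h => h _, fun h w => by
      rw [Subsingleton.elim w fun j => v j]; exact h⟩
  | succ k ih =>
    have := ih (fun P w v => R P (Fin.snoc (α := fun _ => M) w (v 0)) fun i => v (i + 1)) (by
      refine h.congr fun P v =>
        iff_of_eq (congrArg₂ (R P) (funext fun j => ?_) (funext fun i => ?_))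
      · refine Fin.lastCases ?_ (fun j => ?_) j
        · rw [Fin.snoc_last]; simp
        · rw [Fin.snoc_castSucc]; rfl
      · exact congrArg v (by omega : i + 1 + k = i + (k + 1)))
    have := @Def.all _ _ _ _ _ (fun P v x => ∀ w, R P (Fin.snoc (α := fun _ => M) w x) v) this
    refine this.congr fun P v => ⟨fun h x w => h _, fun h w => ?_⟩
    have := h (w (Fin.last k)) (Fin.init w)
    rwa [Fin.snoc_init_self] at this

variable [hM : Fact (M ⊨ PA)]

theorem TDef.realize {β : Type*} (t : LPA.Term β) (g : β → (ℕ → M) → M) (hg : ∀ b, TDef κ (g b)) :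
    TDef κ fun w => t.realize fun b => g b w := by
  induction t with
  | var x => exact hg x
  | func f ts ih =>
    have := ih
    simp only [Term.realize]
    cases f with
    | zero => simp only [funMap_zero]; infer_instance
    | one => simp only [funMap_one]; exact TDef.one
    | succ => simp only [funMap_succ]; infer_instance
    | add => simp only [funMap_add]; infer_instance
    | mul => simp only [funMap_mul]; infer_instance

theorem TDef.liftTerm {n : ℕ} (f : α → (ℕ → M) → M) (g : Fin n → (ℕ → M) → M)
    (hf : ∀ a, TDef κ (f a)) (hg : ∀ j, TDef κ (g j)) (t : LPAP.Term (α ⊕ Fin n)) :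
    TDef κ fun w => (CTPaper.liftTerm (LHom.id LPA) t).realize
      (Sum.elim (fun a => f a w) fun j => g j w) := by
  have := TDef.realize (CTPaper.liftTerm (LHom.id LPA) t) (Sum.elim f g)
    (fun b => by rcases b with b | b; exacts [hf b, hg b])
  refine this.1.elim fun s hs => ⟨s, fun w => (hs w).trans ?_⟩
  congr 1
  funext b
  rcases b <;> rfl

theorem Def.predSat (i : ι) {n : ℕ} (δ : LPAP.BoundedFormula α n) (f : α → (ℕ → M) → M)
    (g : Fin n → (ℕ → M) → M) (hf : ∀ a, TDef κ (f a)) (hg : ∀ j, TDef κ (g j)) :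
    Def κ fun P w => PredSat (P i) δ (fun a => f a w) fun j => g j w := by
  induction δ generalizing f with
  | falsum => exact Def.false
  | equal t s =>
    have := TDef.liftTerm f g hf hg t
    have := TDef.liftTerm f g hf hg s
    simp only [PredSat]; infer_instance
  | rel R ts =>
    have h := fun j => TDef.liftTerm f g hf hg (ts j)
    rcases R with R | R
    · cases R
      have := h 0
      have := h 1
      simp only [PredSat, relMap_le]
      exact Def.le _ _
    · cases R
      have := h 0
      simp only [PredSat]; infer_instance
  | imp φ ψ ih₁ ih₂ =>
    have := ih₁ f g hf hg
    have := ih₂ f g hf hg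
    simp only [PredSat]; infer_instance
  | @all n φ ih =>
    simp only [PredSat]
    refine @Def.all _ _ _ _ _ _ ?_
    refine Def.congr (ih (fun a w => f a fun i => w (i + 1))
      (Fin.snoc (α := fun _ => (ℕ → M) → M) (fun j w => g j fun i => w (i + 1)) fun w => w 0)
      (fun a => TDef.ren (f a) _) fun j => ?_) fun P w => ?_
    · refine Fin.lastCases ?_ (fun j => ?_) j
      · rw [Fin.snoc_last]; infer_instance
      · rw [Fin.snoc_castSucc]; exact TDef.ren (g j) _
    · refine iff_of_eq (congrArg _ (funext fun j => ?_))
      refine Fin.lastCases ?_ (fun j => ?_) j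
      · rw [Fin.snoc_last, Fin.snoc_last]
      · rw [Fin.snoc_castSucc, Fin.snoc_castSucc]

/-- The universal closure of `δ` is definable. -/
theorem Def.forall_predSat (i : ι) {k : ℕ} (δ : LPAP.Formula (Fin k)) :
    Def κ fun P _ => ∀ v : Fin k → M, PredSat (P i) δ v default :=
  Def.forall_fin k (fun P w _ => PredSat (P i) δ w default)
    ((Def.predSat i δ (fun j v => v j) (fun j => j.elim0) (fun _ => inferInstance)
      fun j => j.elim0).congr fun _ _ => iff_of_eq (congrArg _ (Subsingleton.elim _ _)))

end PredicateSubstitution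

/-! ### The main construction -/

section Main

variable {M : Type u} [LPA.Structure M] {k : ℕ} (δ : LPAP.Formula (Fin k))

/-- `B` violates `δ`, or it is not compositional for formulae of depth at most `y`. -/
def Fails (B : M → Prop) (y : M) : Prop :=
  (¬ ∀ v : Fin k → M, PredSat B δ v default) ∨ ∃ x, Depth x y ∧ ¬ (B x ↔ Compose B x)

theorem good_cond {β x : M} (hβ : Good β) (hx : Good x) (j : Bool) :
    Good (bif j then β else x) := by
  cases j <;> assumption

variable [hM : Fact (M ⊨ PA)]

/-- External recursion on `r`: the formula for the previous level replaces the predicate in a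
formula for `Compose`. No parameters arise. -/
theorem exists_partialTruth_formula (r : ℕ) :
    ∃ φ : LPA.Formula (Fin 1), ∀ x : M, φ.Realize (fun _ => x) ↔ partialTruth r x := by
  induction r with
  | zero => exact ⟨⊥, fun x => Iff.rfl⟩
  | succ r ih =>
    obtain ⟨ψ, hψ⟩ := (inferInstance : Def (ι := Unit) (Empty.elim : Empty → M) fun P v =>
      Compose (P ()) (v 0)).exists_pf
    obtain ⟨φ, hφ⟩ := ψ.exists_formula (LHom.id LPA) (fun _ => partialTruth (M := M) r) fun _ => ih
    refine ⟨φ.relabel (Sum.elim Empty.elim fun _ => 0), fun x => ?_⟩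
    rw [Formula.realize_relabel]
    have := (hφ Empty.elim fun _ => x).trans (hψ _ _)
    refine Iff.trans (iff_of_eq (congrArg _ (funext fun b => ?_))) this
    rcases b with b | b
    · exact b.elim
    · rfl

/-- The step of the inner recursion, for the predicates `B` (index `true`) and `D` (index
`false`): `¬ Fails B y ∧ Compose (D(·, y + 1)) x`. -/
theorem exists_stepFormula : ∃ ψ : PF Bool Empty, ∀ (P : Bool → M → Prop) (v : ℕ → M),
    ψ.Sat Empty.elim P v ↔ ∃ x y, v 0 = pair x y ∧ ¬ Fails δ (P true) y ∧
      Compose (fun z => P false (pair z (y + 1))) x := by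
  have : Def (Empty.elim : Empty → M) fun (P : Bool → M → Prop) _ =>
    ∀ v : Fin k → M, PredSat (P true) δ v default := Def.forall_predSat true δ
  have (f : (ℕ → M) → M) [TDef (Empty.elim : Empty → M) f] :
      Def (Empty.elim : Empty → M) fun (P : Bool → M → Prop) v => Fails δ (P true) (f v) := by
    unfold Fails; infer_instance
  exact (inferInstance : Def (Empty.elim : Empty → M) fun (P : Bool → M → Prop) v =>
    ∃ x y, v 0 = pair x y ∧ ¬ Fails δ (P true) y ∧
      Compose (fun z => P false (pair z (y + 1))) x).exists_pf

theorem exists_resultFormula : ∃ ψ : PF Unit Empty, ∀ (P : Unit → M → Prop) (v : ℕ → M),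
    ψ.Sat Empty.elim P v ↔ P () (pair (v 0) 0) :=
  (inferInstance : Def (Empty.elim : Empty → M) fun (P : Unit → M → Prop) v =>
    P () (pair (v 0) 0)).exists_pf

variable {δ} in
-- The only point at which the hypothesis on `δ` is applied: partial truth predicates are standard
-- arithmetical formulae.
theorem forall_predSat_partialTruth
    (hδ : ∀ φ : LPA.Formula (Fin 1), ∀ v : Fin k → M,
      Formula.Realize (substPred (LHom.id LPA) φ δ) v) (r : ℕ) (v : Fin k → M) :
    PredSat (partialTruth r) δ v default := by
  obtain ⟨φ, hφ⟩ := exists_partialTruth_formula (M := M) r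
  have := (realize_substPred (LHom.id LPA) φ δ v default).1 (hδ φ v)
  rwa [funext fun x => propext (hφ x)] at this

/-- The sequence coded by `a, b` iterates `x ↦ wrap ψ (β, x)` up to `c`, starting from `D₀`. -/
def IsIteration (ψ : PF Bool Empty) (D₀ c β a b : M) : Prop :=
  Beta a b 0 D₀ ∧ (∀ i, i ≤ c → ∀ x, Beta a b i x → Good x) ∧
    ∀ i, i < c → ∀ x y, Beta a b i x → Beta a b (i + 1) y →
      y = wrap ψ fun j => bif j then β else x

theorem exists_isIteration (ψ : PF Bool Empty) {D₀ β : M} (hD₀ : Good D₀) (hβ : Good β) (c : M) :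
    ∃ a b, IsIteration ψ D₀ c β a b :=
  exists_iterate (S := fun x y => y = wrap ψ fun j => bif j then β else x) (I := Good)
    inferInstance inferInstance hD₀
    (fun _ hx => ⟨_, good_wrap (good_cond hβ hx) ψ, rfl⟩) c

theorem exists_eq_add_std {c : M} (hc : ∀ n : ℕ, c ≠ std n) (n : ℕ) : ∃ m, c = m + std n := by
  rcases lt_or_ge c (std n) with h | h
  · obtain ⟨m, -, h⟩ := eq_std_of_lt h
    exact absurd h (hc m)
  · obtain ⟨m, h⟩ := le_iff_exists_add'.1 h
    exact ⟨m, by rw [h, add_comm]⟩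

/-! ### Evaluation under `T` and the rank argument. -/

variable [LPred.Structure M] (hCT : ModelsCTMinus M)
include hCT

variable {δ} in
theorem IsIteration.ev_iff {ψ : PF Bool Empty} (hψ : ∀ (P : Bool → M → Prop) (v : ℕ → M),
    ψ.Sat Empty.elim P v ↔ ∃ x y, v 0 = pair x y ∧ ¬ Fails δ (P true) y ∧
      Compose (fun z => P false (pair z (y + 1))) x)
    {c D₀ β a b : M} (hc : ∀ n : ℕ, c ≠ std n) (hβ : Good β) (h : IsIteration ψ D₀ c β a b)
    {r : ℕ} (hr : Fails δ (Ev β) (std r)) (hr' : ∀ i < r, ¬ Fails δ (Ev β) (std i)) :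
    ∀ n i : ℕ, n + i = r → ∀ m D, m + std i = c → Beta a b m D →
      ∀ x, Ev D (pair x (std i)) ↔ partialTruth n x := by
  -- One unfolding lowers the stage `m = c - i` by one and raises the counter `i` by one. As `c` is
  -- nonstandard, `m` is a successor for every standard `i`, so the starting code `D₀` is never
  -- reached.
  have key : ∀ (i : ℕ) (m D : M), m + std i = c → Beta a b m D → ∃ m' D', m' + std (i + 1) = c ∧
      Beta a b m' D' ∧ ∀ x, Ev D (pair x (std i)) ↔
        ¬ Fails δ (Ev β) (std i) ∧ Compose (fun z => Ev D' (pair z (std (i + 1)))) x := by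
    intro i m D hm hD
    obtain ⟨m', hm'⟩ := exists_eq_add_std hc (i + 1)
    have hmm : m = m' + 1 := add_right_cancel (b := std i) (by rw [hm, hm', std_succ]; ring)
    subst hmm
    obtain ⟨D', hD'⟩ := exists_beta_value a b m'
    have hlt : m' < c := by
      rw [hm', std_succ]
      exact lt_iff_add_one_le.2 (le_iff_exists_add'.2 ⟨std i, by ring⟩)
    have hgood := h.2.1 m' hlt.le D' hD'
    refine ⟨m', D', hm'.symm, hD', fun x => ?_⟩
    rw [h.2.2 m' hlt D' D hD' hD, ev_wrap_iff hCT (good_cond hβ hgood), hψ]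
    simp only [cons, pair_inj, cond_true, cond_false, std_succ]
    constructor
    · rintro ⟨_, _, ⟨rfl, rfl⟩, h⟩; exact h
    · exact fun h => ⟨_, _, ⟨rfl, rfl⟩, h⟩
  intro n
  induction n with
  | zero =>
    intro i hi m D hm hD x
    obtain ⟨m', D', -, -, h'⟩ := key i m D hm hD
    rw [h' x, show i = r by omega]
    -- At the counter `r` the guard fails, which yields falsity, that is, `partialTruth 0`.
    exact ⟨fun h => h.1 hr, False.elim⟩
  | succ n ih =>
    intro i hi m D hm hD x
    obtain ⟨m', D', hm', hD', h'⟩ := key i m D hm hD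
    rw [h' x, funext fun z => propext (ih (i + 1) (by omega) m' D' hm' hD' z)]
    exact ⟨fun h => h.2, fun h => ⟨hr' i (by omega), h⟩⟩

/-- Some formula in the sense of `M` satisfies `δ` and is compositional for formulae of standard
depth, according to `T`. -/
theorem exists_good (hN : Nonstandard M)
    (hδ : ∀ φ : LPA.Formula (Fin 1), ∀ v : Fin k → M,
      Formula.Realize (substPred (LHom.id LPA) φ δ) v) :
    ∃ β : M, Good β ∧ ∀ n : ℕ, ¬ Fails δ (Ev β) (std n) := by
  obtain ⟨c, hc⟩ := hN
  obtain ⟨ψ, hψ⟩ := exists_stepFormula (M := M) δ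
  obtain ⟨χ, hχ⟩ := exists_resultFormula (M := M)
  -- An arbitrary good code; it starts both the inner and the outer iteration, and its meaning is
  -- irrelevant.
  set D₀ : M := wrap (.eq (.var 0) (.var 0) : PF Empty Empty) Empty.elim
  have hD₀ : Good D₀ := good_wrap (fun j => j.elim) _
  -- The passage from `β` to `β'` is a relation between codes without any mention of `T`, so
  -- arithmetical induction suffices to iterate it.
  let R : M → M → Prop := fun β β' => ∃ a b D, IsIteration ψ D₀ c β a b ∧ Beta a b c D ∧
    β' = wrap χ fun _ => D
  have hR : DefM fun v => R (v 0) (v 1) := by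
    unfold R IsIteration; infer_instance
  have hstep : ∀ β, Good β → ∃ β', Good β' ∧ R β β' := by
    intro β hβ
    obtain ⟨a, b, h⟩ := exists_isIteration ψ hD₀ hβ c
    obtain ⟨D, hD⟩ := exists_beta_value a b c
    exact ⟨_, good_wrap (fun _ => h.2.1 c le_rfl D hD) χ, a, b, D, h, hD, rfl⟩
  obtain ⟨a, b, -, hgood, hseq⟩ := exists_iterate hR inferInstance hD₀ hstep c
  by_contra! hcon
  -- The rank strictly increases: `β` fails at `r`, while `β'` expresses `partialTruth r` and is
  -- still correct at `r` itself.
  have hrank : ∀ β β', Good β → R β β' → ∃ r : ℕ, Fails δ (Ev β) (std r) ∧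
      ∀ n ≤ r, ¬ Fails δ (Ev β') (std n) := by
    classical
    rintro β β' hβ ⟨a, b, D, h, hD, rfl⟩
    have hex := hcon β hβ
    refine ⟨Nat.find hex, Nat.find_spec hex, fun n hn => ?_⟩
    have : Ev (wrap χ fun _ => D) = partialTruth (Nat.find hex) := by
      funext x
      rw [propext (ev_wrap_iff hCT (fun _ => h.2.1 c le_rfl D hD) χ x), propext (hχ _ _)]
      exact propext (h.ev_iff hCT hψ hc hβ (Nat.find_spec hex) (fun i hi => Nat.find_min hex hi)
        _ 0 (add_zero _) c D (add_zero c) hD x)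
    rw [this]
    rintro (h | ⟨x, hx, h⟩)
    · exact h (forall_predSat_partialTruth hδ _)
    · exact h (partialTruth_fixed hx hn)
  -- Quantifying over all starting positions `m` lets the external induction on `i` count the last
  -- `i + 1` steps before a position, however far it is from `0`.
  have hall : ∀ (i : ℕ) (m β : M), m + std (i + 1) ≤ c → Beta a b (m + std (i + 1)) β →
      ∀ n ≤ i, ¬ Fails δ (Ev β) (std n) := by
    intro i
    induction i with
    | zero =>
      intro m β hm hβ n hn
      obtain ⟨β₁, hβ₁⟩ := exists_beta_value a b m
      rw [std_succ, show (std 0 : M) = 0 from rfl, zero_add] at hm hβ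
      have hlt := lt_iff_add_one_le.2 hm
      obtain ⟨r, -, hr⟩ := hrank β₁ β (hgood m hlt.le β₁ hβ₁) (hseq m hlt β₁ β hβ₁ hβ)
      exact hr n (hn.trans (Nat.zero_le r))
    | succ i ih =>
      intro m β hm hβ n hn
      obtain ⟨β₁, hβ₁⟩ := exists_beta_value a b (m + std (i + 1))
      rw [std_succ (i + 1), ← add_assoc] at hm hβ
      have hlt := lt_iff_add_one_le.2 hm
      obtain ⟨r, hr, hr'⟩ := hrank β₁ β (hgood _ hlt.le β₁ hβ₁) (hseq _ hlt β₁ β hβ₁ hβ)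
      refine hr' n (hn.trans ?_)
      by_contra hlt'
      exact ih m β₁ hlt.le hβ₁ r (by omega) hr
  obtain ⟨β, hβ⟩ := exists_beta_value a b c
  obtain ⟨n, hn⟩ := hcon β (hgood c le_rfl β hβ)
  -- The nonstandard position `c` has at least `n + 1` predecessors, so its entry cannot fail at
  -- `n`.
  obtain ⟨m, hm⟩ := exists_eq_add_std hc (n + 1)
  exact hall n m β hm.ge (hm ▸ hβ) n le_rfl hn

end Main

/-! ### The formula of `LPAT` defining `Ev β`. -/

section Conclusion

variable {M : Type u} [LPA.Structure M] [LPred.Structure M]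

instance : ((lhomWithConstants LPAT M).comp (LHom.sumInl : LPA →ᴸ LPAT)).IsExpansionOn M where
  map_onFunction f x := by
    refine (LHom.map_onFunction (M := M) (lhomWithConstants LPAT M)
      ((LHom.sumInl : LPA →ᴸ LPAT).onFunction f) x).trans ?_
    exact LHom.map_onFunction (M := M) (LHom.sumInl : LPA →ᴸ LPAT) f x
  map_onRelation R x := by
    refine (LHom.map_onRelation (M := M) (lhomWithConstants LPAT M)
      ((LHom.sumInl : LPA →ᴸ LPAT).onRelation R) x).trans ?_
    exact LHom.map_onRelation (M := M) (LHom.sumInl : LPA →ᴸ LPAT) R x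

theorem exists_truth_formula :
    ∃ φ : LPAT[[M]].Formula (Fin 1), ∀ x : M, φ.Realize (fun _ => x) ↔ Tr x := by
  refine ⟨(lhomWithConstants LPAT M).onFormula
    (Relations.formula (Sum.inr UnaryRel.pred : LPAT.Relations 1) fun _ => Term.var 0),
    fun x => ?_⟩
  rw [LHom.realize_onFormula]
  refine (Formula.realize_rel (L := LPAT) (R := (Sum.inr UnaryRel.pred : LPAT.Relations 1))).trans ?_
  refine iff_of_eq (congrArg (Structure.RelMap (L := LPred) UnaryRel.pred) (funext fun i => ?_))
  fin_cases i; rfl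

/-- `Ev β` is arithmetical in `T` with `β` as a parameter. Constants were translated as free
variables, so naming the elements of `M` is the last substitution. -/
theorem exists_ev_formula [Fact (M ⊨ PA)] (β : M) :
    ∃ φ : LPAT[[M]].Formula (Fin 1), ∀ x : M, φ.Realize (fun _ => x) ↔ Ev β x := by
  obtain ⟨ψ, hψ⟩ := (inferInstance : Def (ι := Unit) (id : M → M) fun P v =>
    ∃ r θ', IsClTerm r ∧ HasValue r (v 0) ∧ SubstForm (std 0) r β θ' ∧ P () θ').exists_pf
  obtain ⟨φ, hφ⟩ := ψ.exists_formula ((lhomWithConstants LPAT M).comp LHom.sumInl)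
    (fun _ => Tr (M := M)) fun _ => exists_truth_formula
  refine ⟨BoundedFormula.subst φ
    (Sum.elim (fun m => (LPAT.con m).term) fun _ => Term.var 0), fun x => ?_⟩
  rw [Formula.Realize, BoundedFormula.realize_subst]
  refine Iff.trans (iff_of_eq ?_) ((hφ id fun _ => x).trans (hψ _ _))
  refine congrArg (fun w => BoundedFormula.Realize φ w default) (funext fun b => ?_)
  rcases b with b | b
  · exact Term.realize_constants.trans rfl
  · rfl

end Conclusion

end CTPaper

theorem mainTheorem2 {M : Type u} [LPA.Structure M] [LPred.Structure M]
    (hCT : ModelsCTMinus M) (hM : Nonstandard M)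
    {k : ℕ} (δ : LPAP.Formula (Fin k))
    (hδ : ∀ φ : LPA.Formula (Fin 1), ∀ v : Fin k → M,
      Formula.Realize (substPred (LHom.id LPA) φ δ) v) :
    ∃ T' : LPAT[[M]].Formula (Fin 1),
      UniformDisquotation T' ∧
      ∀ v : Fin k → M,
        Formula.Realize
          (substPred ((lhomWithConstants LPAT M).comp LHom.sumInl) T' δ) v := by
  have : Fact (M ⊨ PA) := ⟨hCT.models_PA⟩
  obtain ⟨β, -, hβ⟩ := exists_good δ hCT hM hδ
  obtain ⟨T', hT'⟩ := exists_ev_formula β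
  -- A violation of `δ` would be a failure already at `0`, since that alternative of `Fails` does
  -- not involve the depth.
  have hδβ : ∀ v : Fin k → M, PredSat (Ev β) δ v default := not_not.1 fun h => hβ 0 (.inl h)
  refine ⟨T', fun ψ t x ht hx => (hT' _).trans (AForm.disquotation (fun n y hy => ?_) ψ ht hx),
    fun v => ?_⟩
  · by_contra h
    exact hβ n (.inr ⟨y, hy, h⟩)
  · refine (realize_substPred _ T' δ v default).2 ?_
    rw [funext fun x => propext (hT' x)]
    exact hδβ v
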